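/- **Theorem 1.4.** Let $A$ be a selfadjoint operator, bounded from below, on a complex Hilbert space $\mathcal H$. Let $Q(A)=D((A-e)^{1/2})$ for $e<\inf\sigma(A)$ be its form domain, $a$ its form, and let $\mathcal H_{+1}$ be $Q(A)$ with the norm $\|(A-e)^{1/2}u\|$ and $\mathcal H_{-1}$ its dual. Let $B_+$ and $B_-$ be nonnegative quadratic forms with form domains containing $Q(A)$ such that: * (relative form compactness) for every $e<\inf\sigma(A)$ there is a compact operator $L_\pm$ on $\mathcal H$ with $B_\pm((A-e)^{-1/2}u,(A-e)^{-1/2}v)=\langle u,L_\pm v\rangle$ for all $u,v\in\mathcal H$; * (factorizability) $B_\pm=C_\pm^*C_\pm$, that is, $B_\pm(u,v)=\langle C_\pm u,C_\pm v\rangle$ for $u,v\in Q(A)$, where $C_\pm:\mathcal H_{+1}\to\mathcal K_\pm$ is a compact operator into some Hilbert space $\mathcal K_\pm$. Write $B_\pm^{1/2}(A-E)^{-1}B_\pm^{1/2}$ for the operator $C_\pm(A-E)^{-1}C_\pm^*$ on $\mathcal K_\pm$, where $C_\pm^*:\mathcal K_\pm\to\mathcal H_{-1}$ and $(A-E)^{-1}:\mathcal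 H_{-1}\to\mathcal H_{+1}$, and let $A+B_+$, $A-B_-$, $A+B_+-B_-$ be the operators associated with the corresponding form sums on $Q(A)$. For a selfadjoint operator $T$ and an open set $I\subset\mathbb R$, let $N(T\in I)=\dim\operatorname{ran}P_I(T)$, where $P_I(T)$ is the spectral projection; $N(T>c)=N(T\in(c,\infty))$ and $N(T<c)=N(T\in(-\infty,c))$. Let $\alpha\le\beta$ be real with $[\alpha,\beta]\subset\mathbb R\setminus\sigma(A)$, and suppose $\alpha,\beta\notin\sigma(A+B_+)\cup\sigma(A-B_-)\cup\sigma(A+B_+-B_-)$. Then $$N(A+B_+-B_-\in(\alpha,\beta))\le N\bigl(B_+^{1/2}(A-\alpha)^{-1}B_+^{1/2}<-1\bigr)+N\bigl(B_-^{1/2}(A-\beta)^{-1}B_-^{1/2}>1\bigr).$$ -/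

import Mathlib

open scoped InnerProductSpace ComplexOrder

noncomputable section

namespace GapBound

variable {H : Type*} [NormedAddCommGroup H] [InnerProductSpace ℂ H]

/-! ### Spectrum and resolvent of an unbounded operator -/

/-- `R` is the bounded everywhere defined inverse of `A - z : D(A) → H`. -/
def IsResolvent (A : H →ₗ.[ℂ] H) (z : ℂ) (R : H →L[ℂ] H) : Prop :=
  (∀ x : H, ∃ h : R x ∈ A.domain, A ⟨R x, h⟩ - z • R x = x) ∧
    ∀ y : A.domain, R (A y - z • (y : H)) = y

/-- The spectrum of an unbounded operator: those `z` for which `A - z` does not have a bounded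
everywhere defined inverse. -/
def spectrum (A : H →ₗ.[ℂ] H) : Set ℂ := {z | ¬ ∃ R, IsResolvent A z R}

open Classical in
/-- The resolvent `(A - z)⁻¹` for `z ∉ σ(A)` (and `0` for `z ∈ σ(A)`). -/
def resolvent (A : H →ₗ.[ℂ] H) (z : ℂ) : H →L[ℂ] H :=
  if h : ∃ R, IsResolvent A z R then h.choose else 0

/-! ### Spectral projections of self-adjoint operators, and the counting function `N` -/

/-- `f(T)` for a self-adjoint operator `T` and a continuous compactly supported `f : ℝ → ℝ`.
The continuous functional calculus is applied to the bounded normal operator `R = (T - i)⁻¹`,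
through `T = R⁻¹ + i`; the point `0` of the spectrum of `R` corresponds to `λ = ∞`, where `f`
vanishes. -/
def funcCalc [CompleteSpace H] (T : H →ₗ.[ℂ] H) (f : ℝ → ℝ) : H →L[ℂ] H :=
  open Classical in
  cfc (fun z : ℂ => if z = 0 then 0 else ((f (z⁻¹ + Complex.I).re : ℝ) : ℂ))
    (resolvent T Complex.I)

/-- The spectral subspace of the self-adjoint operator `T` for an open set `U ⊆ ℝ`: the
indicator function of `U` is the supremum of the continuous functions with values in `[0,1]`
and with compact support in `U`, so the range of the spectral projection is the closed span of
the ranges of `f(T)`, where `f` is continuous with compact support in `U`. -/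
def spectralSubspace [CompleteSpace H] (T : H →ₗ.[ℂ] H) (U : Set ℝ) : Submodule ℂ H :=
  (⨆ f ∈ {f : ℝ → ℝ | Continuous f ∧ HasCompactSupport f ∧ tsupport f ⊆ U},
    LinearMap.range (funcCalc T f).toLinearMap).topologicalClosure

/-- The spectral projection `P_U(T)` of the self-adjoint operator `T` for an open `U ⊆ ℝ`. -/
def spectralProjection [CompleteSpace H] (T : H →ₗ.[ℂ] H) (U : Set ℝ) : H →L[ℂ] H :=
  haveI : CompleteSpace (spectralSubspace T U) :=
    (Submodule.isClosed_topologicalClosure _).completeSpace_coe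
  (spectralSubspace T U).starProjection

/-- `N(T ∈ U) = dim ran P_U(T)`, for `T` self-adjoint and `U ⊆ ℝ` open. -/
def N [CompleteSpace H] (T : H →ₗ.[ℂ] H) (U : Set ℝ) : ℕ∞ :=
  Cardinal.toENat
    (Module.rank ℂ (LinearMap.range (spectralProjection T U).toLinearMap))

/-! ### Forms -/

variable (H) in
/-- A sesquilinear form (conjugate linear in the first argument) defined on a subspace. -/
structure SesqForm where
  domain : Submodule ℂ H
  form : domain →ₗ⋆[ℂ] domain →ₗ[ℂ] ℂ

namespace SesqForm

/-- The restriction of a form to a smaller subspace. -/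
def restrict (t : SesqForm H) (D : Submodule ℂ H) (h : D ≤ t.domain) : D →ₗ⋆[ℂ] D →ₗ[ℂ] ℂ :=
  LinearMap.mk₂'ₛₗ (starRingEnd ℂ) (RingHom.id ℂ)
    (fun u v => t.form (Submodule.inclusion h u) (Submodule.inclusion h v))
    (fun _ _ _ => by simp) (fun _ _ _ => by simp) (fun _ _ _ => by simp) (fun _ _ _ => by simp)

/-- The sum of two forms, on the intersection of their domains. -/
instance : Add (SesqForm H) where
  add s t := ⟨s.domain ⊓ t.domain, s.restrict _ inf_le_left + t.restrict _ inf_le_right⟩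

/-- The difference of two forms, on the intersection of their domains. -/
instance : Sub (SesqForm H) where
  sub s t := ⟨s.domain ⊓ t.domain, s.restrict _ inf_le_left - t.restrict _ inf_le_right⟩

/-- The form is nonnegative: `t(u,u)` is real and `≥ 0` (so `t` is Hermitian). -/
def Nonneg (t : SesqForm H) : Prop := ∀ u : t.domain, 0 ≤ t.form u u

/-- The graph of the operator associated with a form `t`:
`u ∈ Q(t)` is mapped to `w` when `t(v,u) = ⟪v,w⟫` for all `v ∈ Q(t)`. -/
def operatorGraph (t : SesqForm H) : Submodule ℂ (H × H) where
  carrier := {p | ∃ u : t.domain, (u : H) = p.1 ∧ ∀ v : t.domain, t.form v u = ⟪(v : H), p.2⟫_ℂ}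
  add_mem' := by
    rintro p q ⟨u, hu, hu'⟩ ⟨w, hw, hw'⟩
    exact ⟨u + w, by simp [hu, hw], fun v => by simp [hu', hw']⟩
  zero_mem' := ⟨0, by simp, fun v => by simp⟩
  smul_mem' := by
    rintro c p ⟨u, hu, hu'⟩
    exact ⟨c • u, by simp [hu], fun v => by simp [hu']⟩

/-- The operator associated with a (densely defined) form. -/
def operator (t : SesqForm H) : H →ₗ.[ℂ] H := t.operatorGraph.toLinearPMap

end SesqForm

/-- `m` is a lower bound of `A`: `m ‖x‖² ≤ ⟪x, A x⟫` on `D(A)`. -/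
def IsLowerBound (A : H →ₗ.[ℂ] H) (m : ℝ) : Prop :=
  ∀ x : A.domain, m * ‖(x : H)‖ ^ 2 ≤ (⟪(x : H), A x⟫_ℂ).re

/-- `A` is semibounded (bounded from below). -/
def IsSemibounded (A : H →ₗ.[ℂ] H) : Prop := ∃ m : ℝ, IsLowerBound A m

/-- The greatest lower bound of a semibounded operator; for self-adjoint `A` on a nonzero space
it is `inf σ(A)`. -/
def lowerBound (A : H →ₗ.[ℂ] H) : ℝ := sSup {m : ℝ | IsLowerBound A m}

variable [CompleteSpace H]

/-- `(A - e)^{-1/2}` for `A` self-adjoint and `e < inf σ(A)`: the nonnegative square root of the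
nonnegative bounded operator `(A - e)⁻¹`. -/
def invSqrt (A : H →ₗ.[ℂ] H) (e : ℝ) : H →L[ℂ] H := CFC.sqrt (resolvent A (e : ℂ))

/-- `(A - e)^{1/2}`, with domain the range of `(A - e)^{-1/2}`. -/
def sqrtShift (A : H →ₗ.[ℂ] H) (e : ℝ) : H →ₗ.[ℂ] H :=
  ((invSqrt A e).toLinearMap.toPMap ⊤).inverse

/-- The point `inf σ(A) - 1` used to shift `A`. -/
def base (A : H →ₗ.[ℂ] H) : ℝ := lowerBound A - 1

/-- The form of a semibounded self-adjoint operator: with `e = inf σ(A) - 1`, the form domain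
is `Q(A) = D((A - e)^{1/2})` and
`a(u,v) = ⟪(A - e)^{1/2} u, (A - e)^{1/2} v⟫ + e ⟪u,v⟫`. -/
def formOf (A : H →ₗ.[ℂ] H) : SesqForm H where
  domain := (sqrtShift A (base A)).domain
  form :=
    LinearMap.mk₂'ₛₗ (starRingEnd ℂ) (RingHom.id ℂ)
      (fun u v => ⟪sqrtShift A (base A) u, sqrtShift A (base A) v⟫_ℂ +
        (base A : ℂ) * ⟪(u : H), (v : H)⟫_ℂ)
      (fun _ _ _ => by simp only [LinearPMap.map_add, Submodule.coe_add, inner_add_left]; ring)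
      (fun _ _ _ => by
        simp only [LinearPMap.map_smul, Submodule.coe_smul, inner_smul_left, smul_eq_mul]; ring)
      (fun _ _ _ => by simp only [LinearPMap.map_add, Submodule.coe_add, inner_add_right]; ring)
      (fun _ _ _ => by
        simp only [LinearPMap.map_smul, Submodule.coe_smul, inner_smul_right, smul_eq_mul,
          RingHom.id_apply]
        ring)

/-- The form domain `Q(A)`. -/
abbrev formDomain (A : H →ₗ.[ℂ] H) : Submodule ℂ H := (formOf A).domain

/-- The norm of the form space `H₊₁`, i.e. of `Q(A)`: `‖u‖₊₁ = ‖(A - e)^{1/2} u‖` with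
`e = inf σ(A) - 1`, so that `‖u‖₊₁² = a(u,u) - e ‖u‖²`. -/
def formNorm (A : H →ₗ.[ℂ] H) (u : formDomain A) : ℝ := ‖sqrtShift A (base A) u‖

/-- The form `B` is relatively `A`-compact: `Q(A) ⊆ Q(B)` and, for `e < inf σ(A)`,
`(A - e)^{-1/2} B (A - e)^{-1/2}` is (the form of) a compact operator. -/
def IsRelFormCompact (A : H →ₗ.[ℂ] H) (B : SesqForm H) : Prop :=
  formDomain A ≤ B.domain ∧
    ∀ e : ℝ, e < lowerBound A →
      ∃ h : ∀ u : H, invSqrt A e u ∈ B.domain,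
        ∃ L : H →L[ℂ] H, IsCompactOperator L ∧
          ∀ u v : H, B.form ⟨invSqrt A e u, h u⟩ ⟨invSqrt A e v, h v⟩ = ⟪u, L v⟫_ℂ

variable {K : Type*} [NormedAddCommGroup K] [InnerProductSpace ℂ K]

/-- `C` exhibits the form `B` as factorizable: `B = C*C`, i.e. `B(u,v) = ⟪C u, C v⟫` on `Q(A)`,
where `C : H₊₁ → K` is compact, i.e. maps the unit ball of `H₊₁` to a relatively compact set. -/
structure IsFactorization (A : H →ₗ.[ℂ] H) (B : SesqForm H) (C : formDomain A →ₗ[ℂ] K) :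
    Prop where
  compact : IsCompact (closure (C '' {u | formNorm A u ≤ 1}))
  domain_le : formDomain A ≤ B.domain
  form_eq : ∀ u v : formDomain A,
    B.form (Submodule.inclusion domain_le u) (Submodule.inclusion domain_le v) = ⟪C u, C v⟫_ℂ

/-- The graph of `C (A - E)⁻¹ C* : K → K`. For `k : K`, the element `C* k` of the dual `H₋₁` of
`H₊₁` is `v ↦ ⟪C v, k⟫`, and `u = (A - E)⁻¹ C* k` is the element of `H₊₁` such that
`a(v,u) - E ⟪v,u⟫ = ⟪C v, k⟫` for all `v ∈ H₊₁`. The operator maps `k` to `C u`. -/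
def sandwichGraph (A : H →ₗ.[ℂ] H) (C : formDomain A →ₗ[ℂ] K) (E : ℝ) :
    Submodule ℂ (K × K) where
  carrier := {p | ∃ u : formDomain A, C u = p.2 ∧
    ∀ v : formDomain A, (formOf A).form v u - (E : ℂ) * ⟪(v : H), (u : H)⟫_ℂ = ⟪C v, p.1⟫_ℂ}
  add_mem' := by
    rintro p q ⟨u, hu, hu'⟩ ⟨w, hw, hw'⟩
    refine ⟨u + w, by simp [hu, hw], fun v => ?_⟩
    simp only [Prod.fst_add, inner_add_right, ← hu', ← hw', map_add, Submodule.coe_add]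
    ring
  zero_mem' := ⟨0, by simp, fun v => by simp⟩
  smul_mem' := by
    rintro c p ⟨u, hu, hu'⟩
    refine ⟨c • u, by simp [hu], fun v => ?_⟩
    simp only [Prod.smul_fst, inner_smul_right, ← hu', map_smul, Submodule.coe_smul, smul_eq_mul]
    ring

/-- The Birman--Schwinger operator `B^{1/2} (A - E)⁻¹ B^{1/2} = C (A - E)⁻¹ C*` on `K`. -/
def sandwich (A : H →ₗ.[ℂ] H) (C : formDomain A →ₗ[ℂ] K) (E : ℝ) : K →ₗ.[ℂ] K :=
  (sandwichGraph A C E).toLinearPMap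

end GapBound

end

/-! Let `e` be the base point, R = (A - e)⁻¹ and S = R^{1/2}. Substituting u = S x turns every form
on Q(A) into a bounded operator on H: a - E becomes F(E) = 1 - (E - e) R (`shifted`), the factors
C₊, C₋ become compact operators D₁, D₂, and the form sum becomes G(E) = F(E) + D₁*D₁ - D₂*D₂
(`perturbed`). The Birman–Schwinger operators are D F(E)⁻¹ D*, and the resolvent of T = A + B₊ - B₋
at α is S G(α)⁻¹ S.

This resolvent differs from (A - α)⁻¹ by a compact operator, and (A - α)⁻¹ has no spectrum above (β
- α)⁻¹. Its spectral subspaces W strictly above (β - α)⁻¹ are therefore finite-dimensional; they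
correspond to the part of T in (α, β). On V = S⁻¹ W the form G(α) is positive and G(β) is negative.

The dimension of V is bounded by a Fredholm argument (`finrank_le_add_finrank`). Let P and Q be the
negative spectral projections of F(α) and G(α); Q - P is compact. A map H × V → H × (M₁ × M₂), with
M₁, M₂ the two Birman–Schwinger spectral subspaces, is built so that its H-to-H block is the
identity plus a compact operator. If it is injective, then dim V ≤ dim M₁ + dim M₂
(`finrank_le_of_injective_of_isCompactOperator_sub`).

Injectivity is a sign count. Completing the square (`re_inner_add_smul`) with the bounds off M₁ and
M₂ moves a vector positive for G(α) to one positive for F(α), and moves nonnegativity for F(β) back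
to nonnegativity for G(β). Since [α, β] is a gap of A, F(β) is nonnegative on ker P
(`inner_shifted_nonneg`). A nonzero kernel vector would contradict one of these signs. -/

namespace IsCompactOperator

/-! ### Compact perturbations and the Fredholm alternative -/

section Banach

variable {X Y Z : Type*} [NormedAddCommGroup X] [NormedSpace ℂ X] [NormedAddCommGroup Y]
  [NormedSpace ℂ Y] [NormedAddCommGroup Z] [NormedSpace ℂ Z]

theorem comp_clm' {f : Y →L[ℂ] Z} (hf : IsCompactOperator f) (g : X →L[ℂ] Y) :
    IsCompactOperator (f ∘L g) := hf.comp_clm g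

theorem clm_comp' {f : X →L[ℂ] Y} (hf : IsCompactOperator f) (g : Y →L[ℂ] Z) :
    IsCompactOperator (g ∘L f) := hf.clm_comp g

theorem add' {f g : X →L[ℂ] Y} (hf : IsCompactOperator f) (hg : IsCompactOperator g) :
    IsCompactOperator (f + g) := IsCompactOperator.add hf hg

theorem sub' {f g : X →L[ℂ] Y} (hf : IsCompactOperator f) (hg : IsCompactOperator g) :
    IsCompactOperator (f - g) := IsCompactOperator.sub hf hg

theorem neg' {f : X →L[ℂ] Y} (hf : IsCompactOperator f) :
    IsCompactOperator (-f) := IsCompactOperator.neg hf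

theorem of_finiteDimensional_dom [FiniteDimensional ℂ X] (f : X →L[ℂ] Y) :
    IsCompactOperator f := by
  have : ProperSpace X := FiniteDimensional.proper ℂ X
  exact isCompactOperator_of_locallyCompactSpace_rng f

theorem of_finiteDimensional_rng [FiniteDimensional ℂ Y] (f : X →L[ℂ] Y) :
    IsCompactOperator f := by
  have : ProperSpace Y := FiniteDimensional.proper ℂ Y
  exact isCompactOperator_of_locallyCompactSpace_dom f

/-- Fredholm alternative: an injective compact perturbation of the identity is invertible. -/
theorem isUnit_one_add [CompleteSpace X] {k : X →L[ℂ] X} (hk : IsCompactOperator k)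
    (h : ∀ x, x + k x = 0 → x = 0) : IsUnit (1 + k) := by
  rcases hk.hasEigenvalue_or_mem_resolventSet (μ := (-1 : ℂ)) (by norm_num) with h1 | h1
  · obtain ⟨v, hv, hv0⟩ := h1.exists_hasEigenvector
    refine absurd (h v ?_) hv0
    have : k v = (-1 : ℂ) • v := Module.End.mem_eigenspace_iff.1 hv
    rw [this]; simp
  · rw [spectrum.mem_resolventSet_iff, ← IsUnit.neg_iff] at h1
    convert h1 using 1
    ext x; simp [add_comm]

/-- Fredholm alternative for compact perturbations of an invertible operator. -/
theorem isUnit_of_sub [CompleteSpace X] {f g : X →L[ℂ] X} (hf : IsUnit f)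
    (hk : IsCompactOperator (g - f)) (h : ∀ x, g x = 0 → x = 0) : IsUnit g := by
  obtain ⟨u, rfl⟩ := hf
  have h1 : IsUnit (1 + (↑u⁻¹ : X →L[ℂ] X) ∘L (g - (u : X →L[ℂ] X))) := by
    refine isUnit_one_add (hk.clm_comp' _) fun x hx => h x ?_
    have h2 : (u : X →L[ℂ] X) (x + (↑u⁻¹ : X →L[ℂ] X) ((g - (u : X →L[ℂ] X)) x)) = g x := by
      have : ∀ y, (u : X →L[ℂ] X) ((↑u⁻¹ : X →L[ℂ] X) y) = y := fun y => by
        rw [← mul_apply_eq_comp, Units.mul_inv]; simp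
      rw [map_add, this]; simp
    rw [← h2]
    simp only [ContinuousLinearMap.comp_apply] at hx
    rw [hx, map_zero]
  -- Factoring out the invertible operator leaves the identity plus a compact operator with the same
  -- kernel as g.
  have h3 : g = u * (1 + (↑u⁻¹ : X →L[ℂ] X) ∘L (g - (u : X →L[ℂ] X))) := by
    rw [← ContinuousLinearMap.mul_def, mul_add, Units.mul_inv_cancel_left]; simp
  rw [h3]
  exact u.isUnit.mul h1

theorem mul_sub_mul {f g f' g' : X →L[ℂ] X} (h : IsCompactOperator (f - g))
    (h' : IsCompactOperator (f' - g')) : IsCompactOperator (f * f' - g * g') := by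
  have : f * f' - g * g' = (f - g) ∘L f' + g ∘L (f' - g') := by
    simp only [← ContinuousLinearMap.mul_def]; noncomm_ring
  rw [this]
  exact (h.comp_clm' _).add' (h'.clm_comp' _)

theorem aeval_sub_aeval {f g : X →L[ℂ] X} (h : IsCompactOperator (f - g)) (p : Polynomial ℝ) :
    IsCompactOperator (Polynomial.aeval f p - Polynomial.aeval g p) := by
  induction p using Polynomial.induction_on' with
  | add p q hp hq =>
    rw [map_add, map_add, add_sub_add_comm]; exact hp.add' hq
  | monomial n a =>
    have hn : ∀ n : ℕ, IsCompactOperator (f ^ n - g ^ n) := fun n => by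
      induction n with
      | zero => simpa using isCompactOperator_zero
      | succ n ih => rw [pow_succ, pow_succ]; exact ih.mul_sub_mul h
    rw [Polynomial.aeval_monomial, Polynomial.aeval_monomial, ← mul_sub,
      ContinuousLinearMap.mul_def]
    exact (hn n).clm_comp' _

/-- From u⁻¹ - w⁻¹ = u⁻¹ (w - u) w⁻¹ and the ideal property of compact operators. -/
theorem inv_sub_inv {u w : (X →L[ℂ] X)ˣ}
    (h : IsCompactOperator ((u : X →L[ℂ] X) - (w : X →L[ℂ] X) : X →L[ℂ] X)) :
    IsCompactOperator ((↑u⁻¹ : X →L[ℂ] X) - (↑w⁻¹ : X →L[ℂ] X) : X →L[ℂ] X) := by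
  have : (↑u⁻¹ : X →L[ℂ] X) - (↑w⁻¹ : X →L[ℂ] X) =
      (↑u⁻¹ : X →L[ℂ] X) ∘L ((-((u : X →L[ℂ] X) - (w : X →L[ℂ] X))) ∘L (↑w⁻¹ : X →L[ℂ] X)) := by
    simp only [← ContinuousLinearMap.mul_def, neg_sub, sub_mul, mul_sub, Units.mul_inv, mul_one,
      Units.inv_mul_cancel_left]
  rw [this]
  exact (h.neg'.comp_clm' _).clm_comp' _

end Banach

/-! ### Functional calculus modulo compact operators -/

section Hilbert

variable {H : Type*} [NormedAddCommGroup H] [InnerProductSpace ℂ H] [CompleteSpace H]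

/-- The continuous functional calculi of two self-adjoint operators with compact difference differ
by compact operators. -/
theorem cfc_sub_cfc_of_continuous {x y : H →L[ℂ] H} (hx : IsSelfAdjoint x) (hy : IsSelfAdjoint y)
    (h : IsCompactOperator (x - y)) {f : ℝ → ℝ} (hf : Continuous f) :
    IsCompactOperator (cfc f x - cfc f y) := by
  obtain ⟨M, hM⟩ := ((spectrum.isCompact (𝕜 := ℝ) x).union
    (spectrum.isCompact (𝕜 := ℝ) y)).isBounded.subset_closedBall 0
  -- Weierstrass on an interval containing both spectra; a norm limit of compact operators is
  -- compact.
  have hex : ∀ n : ℕ, ∃ p : Polynomial ℝ, ∀ t ∈ Set.Icc (-M) M, |p.eval t - f t| < 1 / (n + 1) :=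
    fun n => exists_polynomial_near_of_continuousOn _ _ f hf.continuousOn _ (by positivity)
  choose p hp using hex
  have key : ∀ z : H →L[ℂ] H, IsSelfAdjoint z → spectrum ℝ z ⊆ Set.Icc (-M) M →
      Filter.Tendsto (fun n => Polynomial.aeval z (p n)) Filter.atTop (nhds (cfc f z)) := by
    intro z hz hs
    rw [tendsto_iff_norm_sub_tendsto_zero]
    refine squeeze_zero (fun _ => norm_nonneg _) (fun n => ?_)
      (tendsto_one_div_add_atTop_nhds_zero_nat (𝕜 := ℝ))
    rw [← cfc_polynomial (p n) z hz, ← cfc_sub _ _ z (p n).continuous.continuousOn hf.continuousOn]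
    exact norm_cfc_le (by positivity) fun t ht => (hp n t (hs ht)).le
  have hI : ∀ z : Set ℝ, z ⊆ Metric.closedBall 0 M → z ⊆ Set.Icc (-M) M := fun z hz t ht => by
    have := hz ht
    rw [mem_closedBall_zero_iff, Real.norm_eq_abs] at this
    exact abs_le.1 this
  exact isCompactOperator_of_tendsto
    ((key x hx (hI _ (Set.subset_union_left.trans hM))).sub
      (key y hy (hI _ (Set.subset_union_right.trans hM))))
    (Filter.Eventually.of_forall fun n => h.aeval_sub_aeval (p n))

/-- Tietze extension from the union of the spectra. This admits step functions, hence spectral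
projections at a gap. -/
theorem cfc_sub_cfc {x y : H →L[ℂ] H} (hx : IsSelfAdjoint x) (hy : IsSelfAdjoint y)
    (h : IsCompactOperator (x - y)) {f : ℝ → ℝ}
    (hf : ContinuousOn f (spectrum ℝ x ∪ spectrum ℝ y)) :
    IsCompactOperator (cfc f x - cfc f y) := by
  obtain ⟨g, hg⟩ := ContinuousMap.exists_restrict_eq
    ((spectrum.isClosed (𝕜 := ℝ) x).union (spectrum.isClosed (𝕜 := ℝ) y))
    ⟨_, continuousOn_iff_continuous_domRestrict.1 hf⟩
  have hfg : ∀ t ∈ spectrum ℝ x ∪ spectrum ℝ y, f t = g t := fun t ht =>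
    (DFunLike.congr_fun hg ⟨t, ht⟩).symm
  rw [cfc_congr (a := x) (g := g) fun t ht => hfg t (Or.inl ht),
    cfc_congr (a := y) (g := g) fun t ht => hfg t (Or.inr ht)]
  exact cfc_sub_cfc_of_continuous hx hy h g.continuous

end Hilbert

end IsCompactOperator

namespace SpectralGap

/-! ### Dimension count by the Fredholm alternative -/

section Index

variable {X V M : Type*} [NormedAddCommGroup X] [NormedSpace ℂ X] [CompleteSpace X]
  [NormedAddCommGroup V] [NormedSpace ℂ V] [FiniteDimensional ℂ V]
  [NormedAddCommGroup M] [NormedSpace ℂ M] [FiniteDimensional ℂ M]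

/-- If `(Ψ, Φ) : X × V → X × M` is injective and `Ψ` is a compact perturbation of the identity
on `X`, then `dim V ≤ dim M`. -/
theorem finrank_le_of_injective_of_isCompactOperator_sub (Ψ : X × V →L[ℂ] X) (Φ : X × V →L[ℂ] M)
    (hΨ : IsCompactOperator (Ψ ∘L ContinuousLinearMap.inl ℂ X V - 1 : X →L[ℂ] X))
    (h : ∀ p, Ψ p = 0 → Φ p = 0 → p = 0) : Module.finrank ℂ V ≤ Module.finrank ℂ M := by
  have : CompleteSpace V := FiniteDimensional.complete ℂ V
  by_contra! hlt
  -- If dim M < dim V, embed M in V by ι. Then (Ψ, ιΦ) is an injective compact perturbation of the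
  -- identity on X × V, hence surjective, which forces ι to be surjective.
  obtain ⟨ι, hι⟩ : ∃ ι : M →ₗ[ℂ] V, Function.Injective ι :=
    finrank_le_iff_exists_linearMap.1 hlt.le
  let ι' : M →L[ℂ] V := LinearMap.toContinuousLinearMap ι
  let k : X × V →L[ℂ] X × V :=
    ContinuousLinearMap.inl ℂ X V ∘L ((Ψ ∘L ContinuousLinearMap.inl ℂ X V - 1) ∘L
      ContinuousLinearMap.fst ℂ X V) +
    (ContinuousLinearMap.inl ℂ X V ∘L Ψ ∘L ContinuousLinearMap.inr ℂ X V) ∘L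
      ContinuousLinearMap.snd ℂ X V +
    ContinuousLinearMap.inr ℂ X V ∘L (ι' ∘L Φ - ContinuousLinearMap.snd ℂ X V)
  have hk : IsCompactOperator k :=
    (((hΨ.comp_clm' _).clm_comp' _).add'
      ((IsCompactOperator.of_finiteDimensional_dom _).comp_clm' _)).add'
      ((IsCompactOperator.of_finiteDimensional_rng _).clm_comp' _)
  have hk' : ∀ p, p + k p = (Ψ p, ι (Φ p)) := by
    rintro ⟨x, v⟩
    have : Ψ (x, v) = Ψ (x, 0) + Ψ (0, v) := by rw [← map_add]; simp
    simp [k, ι', this]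
    abel
  have hu := hk.isUnit_one_add fun p hp => by
    rw [hk'] at hp
    refine h p (congrArg Prod.fst hp) (hι ?_)
    rw [map_zero]; exact congrArg Prod.snd hp
  have hs : Function.Surjective ι := fun v => by
    obtain ⟨p, hp⟩ := (ContinuousLinearMap.isUnit_iff_bijective.1 hu).2 (0, v)
    exact ⟨Φ p, by simpa [hk'] using congrArg Prod.snd hp⟩
  exact hlt.not_ge (LinearMap.finrank_le_finrank_of_surjective hs)

end Index

/-! ### Signs of quadratic forms on spectral subspaces -/

section Sign

variable {H : Type*} [NormedAddCommGroup H] [InnerProductSpace ℂ H]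

theorem re_inner_nonneg_of_nonneg {x : H →L[ℂ] H} (hx : 0 ≤ x) (z : H) :
    0 ≤ (⟪z, x z⟫_ℂ).re :=
  ((ContinuousLinearMap.nonneg_iff_isPositive x).1 hx).re_inner_nonneg_right z

variable [CompleteSpace H]

/-- If `z` is fixed by `χ(x)`, then `⟪z, φ(x) z⟫ ≥ 0` as soon as `χ φ ≥ 0` on the spectrum. -/
theorem re_inner_cfc_nonneg {x : H →L[ℂ] H} {χ φ : ℝ → ℝ}
    (hχ : ContinuousOn χ (spectrum ℝ x)) (hφ : ContinuousOn φ (spectrum ℝ x))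
    (hpos : ∀ t ∈ spectrum ℝ x, 0 ≤ φ t * χ t) {z : H} (hz : cfc χ x z = z) :
    0 ≤ (⟪z, cfc φ x z⟫_ℂ).re := by
  have h1 : cfc φ x z = cfc (fun t => φ t * χ t) x z := by
    rw [cfc_mul φ χ x hφ hχ, mul_apply_eq_comp, hz]
  rw [h1]
  exact re_inner_nonneg_of_nonneg (cfc_nonneg hpos) z

/-- The spectral projection of an invertible self-adjoint operator for the negative half-line. -/
noncomputable def negProj (x : H →L[ℂ] H) : H →L[ℂ] H := cfc (fun t : ℝ => if t < 0 then 1 else 0) x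

theorem continuousOn_ite_neg {s : Set ℝ} (hs : (0 : ℝ) ∉ s) :
    ContinuousOn (fun t : ℝ => if t < 0 then (1 : ℝ) else 0) s := by
  intro t ht
  have ht0 : t ≠ 0 := fun h => hs (h ▸ ht)
  refine ContinuousAt.continuousWithinAt ?_
  rcases lt_or_gt_of_ne ht0 with h | h
  · refine (continuousAt_const (y := (1 : ℝ))).congr ?_
    filter_upwards [gt_mem_nhds h] with u hu
    simp [hu]
  · refine (continuousAt_const (y := (0 : ℝ))).congr ?_
    filter_upwards [lt_mem_nhds h] with u hu
    simp [not_lt.2 hu.le]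

theorem negProj_mul_self {x : H →L[ℂ] H} (hu : IsUnit x) : negProj x * negProj x = negProj x := by
  have hc := continuousOn_ite_neg (spectrum.zero_notMem ℝ hu)
  rw [negProj, ← cfc_mul _ _ x hc hc]
  congr 1; ext t; split_ifs <;> simp

theorem one_sub_negProj {x : H →L[ℂ] H} (hx : IsSelfAdjoint x) (hu : IsUnit x) :
    1 - negProj x = cfc (fun t : ℝ => 1 - if t < 0 then (1 : ℝ) else 0) x := by
  have hc := continuousOn_ite_neg (spectrum.zero_notMem ℝ hu)
  rw [cfc_sub (fun _ => (1 : ℝ)) _ x continuousOn_const hc, cfc_const_one ℝ x, negProj]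

theorem exists_pos_forall_spectrum_le_abs {x : H →L[ℂ] H} (hu : IsUnit x) :
    ∃ δ > 0, ∀ t ∈ spectrum ℝ x, δ ≤ |t| := by
  obtain ⟨δ, hδ, h⟩ := Metric.isOpen_iff.1 (spectrum.isClosed (𝕜 := ℝ) x).isOpen_compl 0
    (spectrum.zero_notMem ℝ hu)
  refine ⟨δ, hδ, fun t ht => ?_⟩
  by_contra! hlt
  exact h (by simpa using hlt) ht

/-- Invertibility keeps the spectrum a distance δ from 0, so x ≤ -δ on its negative subspace; this
gives strictness. -/
theorem inner_neg_of_negProj {x : H →L[ℂ] H} (hx : IsSelfAdjoint x) (hu : IsUnit x) {z : H}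
    (hz : negProj x z = z) (hz0 : z ≠ 0) : (⟪z, x z⟫_ℂ).re < 0 := by
  obtain ⟨δ, hδ, h⟩ := exists_pos_forall_spectrum_le_abs hu
  have hc := continuousOn_ite_neg (spectrum.zero_notMem ℝ hu)
  have h1 := re_inner_cfc_nonneg (φ := fun t => -δ - t) hc (by fun_prop) (fun t ht => by
    have := h t ht
    split_ifs with h0
    · rw [abs_of_neg h0] at this; linarith
    · simp) hz
  rw [cfc_sub (fun _ => -δ) (fun t => t) x, cfc_const _ _ hx, cfc_id' ℝ x] at h1
  have h2 : (⟪z, (algebraMap ℝ (H →L[ℂ] H) (-δ)) z⟫_ℂ).re = -δ * ‖z‖ ^ 2 := by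
    rw [Algebra.algebraMap_eq_smul_one, smul_apply, one_apply_eq_self,
      inner_smul_right_eq_smul, Complex.smul_re, ← inner_self_eq_norm_sq (𝕜 := ℂ)]
    rfl
  rw [sub_apply, inner_sub_right, Complex.sub_re, h2] at h1
  have := mul_pos hδ (pow_pos (norm_pos_iff.2 hz0) 2)
  linarith

theorem inner_pos_of_negProj {x : H →L[ℂ] H} (hx : IsSelfAdjoint x) (hu : IsUnit x) {z : H}
    (hz : negProj x z = 0) (hz0 : z ≠ 0) : 0 < (⟪z, x z⟫_ℂ).re := by
  obtain ⟨δ, hδ, h⟩ := exists_pos_forall_spectrum_le_abs hu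
  have hc := continuousOn_ite_neg (spectrum.zero_notMem ℝ hu)
  have hz' : cfc (fun t : ℝ => 1 - if t < 0 then (1 : ℝ) else 0) x z = z := by
    rw [← one_sub_negProj hx hu]; simp [hz]
  have h1 := re_inner_cfc_nonneg (φ := fun t => t - δ) (by fun_prop) (by fun_prop) (fun t ht => by
    have := h t ht
    split_ifs with h0
    · simp
    · rw [abs_of_nonneg (not_lt.1 h0)] at this; linarith) hz'
  rw [cfc_sub (fun t => t) (fun _ => δ) x, cfc_const _ _ hx, cfc_id' ℝ x] at h1
  have h2 : (⟪z, (algebraMap ℝ (H →L[ℂ] H) δ) z⟫_ℂ).re = δ * ‖z‖ ^ 2 := by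
    rw [Algebra.algebraMap_eq_smul_one, smul_apply, one_apply_eq_self,
      inner_smul_right_eq_smul, Complex.smul_re, ← inner_self_eq_norm_sq (𝕜 := ℂ)]
    rfl
  rw [sub_apply, inner_sub_right, Complex.sub_re, h2] at h1
  have := mul_pos hδ (pow_pos (norm_pos_iff.2 hz0) 2)
  linarith

/-- The operator `1 - E R`, through which the form of `A - E` is expressed when `R` is the
resolvent of `A` at the base point. -/
noncomputable def shifted (R : H →L[ℂ] H) (E : ℝ) : H →L[ℂ] H := 1 - E • R

theorem shifted_eq_cfc {R : H →L[ℂ] H} (hR : IsSelfAdjoint R) (E : ℝ) :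
    shifted R E = cfc (fun r : ℝ => 1 - E * r) R := by
  rw [cfc_sub (fun _ => (1 : ℝ)) (fun r => E * r) R, cfc_const_one ℝ R,
    cfc_const_mul_id E R, shifted]

theorem isSelfAdjoint_shifted {R : H →L[ℂ] H} (hR : IsSelfAdjoint R) (E : ℝ) :
    IsSelfAdjoint (shifted R E) := by
  rw [shifted_eq_cfc hR]; exact cfc_predicate _ _

theorem shifted_spectrum_ne_zero {R : H →L[ℂ] H} (hR : IsSelfAdjoint R) {E : ℝ}
    (hu : IsUnit (shifted R E)) {r : ℝ} (hr : r ∈ spectrum ℝ R) : 1 - E * r ≠ 0 := by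
  rw [shifted_eq_cfc hR, isUnit_cfc_iff _ _ (by fun_prop)] at hu
  exact hu r hr

/-- In a gap the sign of `1 - E r` does not depend on `E`. -/
theorem shifted_sign {R : H →L[ℂ] H} (hR : IsSelfAdjoint R) {a b : ℝ} (hab : a ≤ b)
    (hF : ∀ E ∈ Set.Icc a b, IsUnit (shifted R E)) {r : ℝ} (hr : r ∈ spectrum ℝ R)
    (h : 0 ≤ 1 - a * r) : 0 ≤ 1 - b * r := by
  by_contra! hlt
  -- A change of sign would make 1 - E r vanish for some E in the gap.
  obtain ⟨E, hE, h0⟩ := intermediate_value_Icc' (f := fun E : ℝ => 1 - E * r) hab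
    (by fun_prop) ⟨hlt.le, h⟩
  exact shifted_spectrum_ne_zero hR (hF E hE) hr h0

/-- The negative projection at a is a function of R, and its kernel only sees those r with 1 - a r ≥
0. For these, 1 - b r ≥ 0 by `shifted_sign`. -/
theorem inner_shifted_nonneg {R : H →L[ℂ] H} (hR : IsSelfAdjoint R) {a b : ℝ} (hab : a ≤ b)
    (hF : ∀ E ∈ Set.Icc a b, IsUnit (shifted R E)) {z : H} (hz : negProj (shifted R a) z = 0) :
    0 ≤ (⟪z, shifted R b z⟫_ℂ).re := by
  have ha := hF a ⟨le_rfl, hab⟩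
  have hsub : (fun r : ℝ => 1 - a * r) '' spectrum ℝ R ⊆ {0}ᶜ := by
    rintro _ ⟨r, hr, rfl⟩; exact shifted_spectrum_ne_zero hR ha hr
  have hc : ContinuousOn (fun t : ℝ => if t < 0 then (1 : ℝ) else 0)
      ((fun r : ℝ => 1 - a * r) '' spectrum ℝ R) :=
    (continuousOn_ite_neg (s := {0}ᶜ) (by simp)).mono hsub
  have hc' : ContinuousOn (fun r : ℝ => 1 - if 1 - a * r < 0 then (1 : ℝ) else 0)
      (spectrum ℝ R) :=
    continuousOn_const.sub (hc.comp (by fun_prop) (Set.mapsTo_image _ _))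
  have hz' : cfc (fun r : ℝ => 1 - if 1 - a * r < 0 then (1 : ℝ) else 0) R z = z := by
    rw [cfc_sub (fun _ => (1 : ℝ)) (fun r => if 1 - a * r < 0 then (1 : ℝ) else 0) R
      continuousOn_const (hc.comp (by fun_prop) (Set.mapsTo_image _ _)), cfc_const_one ℝ R]
    rw [cfc_comp' (fun t : ℝ => if t < 0 then (1 : ℝ) else 0) (fun r => 1 - a * r) R hc,
      ← shifted_eq_cfc hR]
    change z - negProj (shifted R a) z = z
    rw [hz, sub_zero]
  rw [shifted_eq_cfc hR b]
  refine re_inner_cfc_nonneg hc' (by fun_prop) (fun r hr => ?_) hz'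
  split_ifs with h
  · simp
  · simpa using shifted_sign hR hab hF hr (not_lt.1 h)

end Sign

/-! ### The main dimension estimate for bounded operators -/

section Core

variable {H : Type*} [NormedAddCommGroup H] [InnerProductSpace ℂ H] [CompleteSpace H]
  {K : Type*} [NormedAddCommGroup K] [InnerProductSpace ℂ K] [CompleteSpace K]

/-- Schur complement identity: if `F y = D* D x`, then
`f(x + c y) = f(x) + 2 c ‖D x‖² + c² ⟪D x, D y⟫` for `c` real. -/
theorem re_inner_add_smul {F : H →L[ℂ] H} (hF : IsSelfAdjoint F) (D : H →L[ℂ] K) {x y : H}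
    (hy : F y = D.adjoint (D x)) (c : ℝ) :
    (⟪x + c • y, F (x + c • y)⟫_ℂ).re =
      (⟪x, F x⟫_ℂ).re + 2 * c * ‖D x‖ ^ 2 + c ^ 2 * (⟪D x, D y⟫_ℂ).re := by
  have h1 : ⟪x, F y⟫_ℂ = ⟪D x, D x⟫_ℂ := by
    rw [hy, ContinuousLinearMap.adjoint_inner_right]
  have h2 : ⟪y, F x⟫_ℂ = ⟪D x, D x⟫_ℂ := by
    rw [← ContinuousLinearMap.adjoint_inner_left, hF.adjoint_eq, hy,
      ContinuousLinearMap.adjoint_inner_left]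
  have h3 : (⟪y, F y⟫_ℂ).re = (⟪D x, D y⟫_ℂ).re := by
    rw [hy, ContinuousLinearMap.adjoint_inner_right, ← inner_conj_symm, Complex.conj_re]
  have h4 : (⟪D x, D x⟫_ℂ).re = ‖D x‖ ^ 2 := by
    rw [← inner_self_eq_norm_sq (𝕜 := ℂ)]; rfl
  have h5 : F (x + c • y) = F x + (c : ℂ) • F y := by
    rw [map_add, ← Complex.coe_smul, map_smul]
  rw [h5, ← Complex.coe_smul, inner_add_left, inner_add_right, inner_add_right, inner_smul_left,
    inner_smul_left, inner_smul_right, inner_smul_right, h1, h2, Complex.conj_ofReal]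
  simp only [Complex.add_re, Complex.re_ofReal_mul, h3, h4]
  ring

variable {K₁ : Type*} [NormedAddCommGroup K₁] [InnerProductSpace ℂ K₁] [CompleteSpace K₁]
  {K₂ : Type*} [NormedAddCommGroup K₂] [InnerProductSpace ℂ K₂] [CompleteSpace K₂]

/-- The perturbation of `1 - E R` by `D₁* D₁ - D₂* D₂`. -/
noncomputable def perturbed (R : H →L[ℂ] H) (D₁ : H →L[ℂ] K₁) (D₂ : H →L[ℂ] K₂) (E : ℝ) :
    H →L[ℂ] H :=
  shifted R E + D₁.adjoint ∘L D₁ - D₂.adjoint ∘L D₂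

theorem isSelfAdjoint_adjoint_comp_self (D : H →L[ℂ] K) : IsSelfAdjoint (D.adjoint ∘L D) :=
  (ContinuousLinearMap.isPositive_adjoint_comp_self D).isSelfAdjoint

variable {R : H →L[ℂ] H} {D₁ : H →L[ℂ] K₁} {D₂ : H →L[ℂ] K₂}

theorem isSelfAdjoint_perturbed (hR : IsSelfAdjoint R) (E : ℝ) :
    IsSelfAdjoint (perturbed R D₁ D₂ E) :=
  ((isSelfAdjoint_shifted hR E).add (isSelfAdjoint_adjoint_comp_self D₁)).sub
    (isSelfAdjoint_adjoint_comp_self D₂)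

theorem isCompactOperator_perturbed_sub_shifted (hD₁ : IsCompactOperator D₁)
    (hD₂ : IsCompactOperator D₂) (E : ℝ) :
    IsCompactOperator (perturbed R D₁ D₂ E - shifted R E) := by
  have : perturbed R D₁ D₂ E - shifted R E = D₁.adjoint ∘L D₁ - D₂.adjoint ∘L D₂ := by
    rw [perturbed]; abel
  rw [this]
  exact (hD₁.clm_comp' _).sub' (hD₂.clm_comp' _)

theorem re_inner_perturbed (E : ℝ) (x : H) :
    (⟪x, perturbed R D₁ D₂ E x⟫_ℂ).re =
      (⟪x, shifted R E x⟫_ℂ).re + ‖D₁ x‖ ^ 2 - ‖D₂ x‖ ^ 2 := by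
  simp only [perturbed, sub_apply, add_apply, ContinuousLinearMap.comp_apply, inner_sub_right,
    inner_add_right, ContinuousLinearMap.adjoint_inner_right, Complex.sub_re, Complex.add_re]
  rw [← inner_self_eq_norm_sq (𝕜 := ℂ) (D₁ x), ← inner_self_eq_norm_sq (𝕜 := ℂ) (D₂ x)]
  rfl

theorem perturbed_apply_eq (a b : ℝ) (x : H) :
    perturbed R D₁ D₂ b x = perturbed R D₁ D₂ a x - (b - a) • R x := by
  simp only [perturbed, shifted, sub_apply, add_apply, smul_apply, sub_smul]
  abel

/-- Both cross terms vanish, so the form of G splits along V and its R-orthogonal complement. -/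
theorem re_inner_add_of_inner_eq_zero {G : H →L[ℂ] H} (hG : IsSelfAdjoint G) {z v : H}
    (h : ⟪G v, z⟫_ℂ = 0) :
    (⟪z + v, G (z + v)⟫_ℂ).re = (⟪z, G z⟫_ℂ).re + (⟪v, G v⟫_ℂ).re := by
  have h1 : ⟪v, G z⟫_ℂ = 0 := by
    rw [← ContinuousLinearMap.adjoint_inner_left, hG.adjoint_eq, h]
  have h2 : ⟪z, G v⟫_ℂ = 0 := by rw [← inner_conj_symm, h, map_zero]
  rw [map_add, inner_add_left, inner_add_right, inner_add_right, h1, h2]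
  simp

/-- Let `V` be a finite-dimensional subspace which, in the sense of forms, reduces the operator
`G` of the perturbed form, and which lies between `a` and `b`. Then its dimension is bounded by
the dimensions of subspaces `M₁` and `M₂` outside of which the two Birman--Schwinger operators
are `≥ -1` and `≤ 1`, respectively. -/
theorem finrank_le_add_finrank (hR : 0 ≤ R) {a b : ℝ} (hab : a ≤ b)
    (hF : ∀ E ∈ Set.Icc a b, IsUnit (shifted R E))
    (hD₁ : IsCompactOperator D₁) (hD₂ : IsCompactOperator D₂)
    (hG : IsUnit (perturbed R D₁ D₂ a))
    (V : Submodule ℂ H) [FiniteDimensional ℂ V] (q : H →L[ℂ] H) (hqV : ∀ x, q x ∈ V)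
    (hq : ∀ v ∈ V, ∀ x, ⟪R v, x - q x⟫_ℂ = 0)
    (hV : ∀ v ∈ V, ∃ v' ∈ V, perturbed R D₁ D₂ a v = R v')
    (hpos : ∀ v ∈ V, v ≠ 0 → 0 < (⟪v, perturbed R D₁ D₂ a v⟫_ℂ).re)
    (hneg : ∀ v ∈ V, v ≠ 0 → (⟪v, perturbed R D₁ D₂ b v⟫_ℂ).re < 0)
    (M₁ : Submodule ℂ K₁) [FiniteDimensional ℂ M₁]
    (hM₁ : ∀ k ∈ M₁ᗮ, ∀ y, shifted R a y = D₁.adjoint k → -‖k‖ ^ 2 ≤ (⟪k, D₁ y⟫_ℂ).re)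
    (M₂ : Submodule ℂ K₂) [FiniteDimensional ℂ M₂]
    (hM₂ : ∀ k ∈ M₂ᗮ, ∀ y, shifted R b y = D₂.adjoint k → (⟪k, D₂ y⟫_ℂ).re ≤ ‖k‖ ^ 2) :
    Module.finrank ℂ V ≤ Module.finrank ℂ M₁ + Module.finrank ℂ M₂ := by
  have hRs : IsSelfAdjoint R := .of_nonneg hR
  have hua := hF a ⟨le_rfl, hab⟩
  have hub := hF b ⟨hab, le_rfl⟩
  have hFs := isSelfAdjoint_shifted hRs
  have hGs : ∀ E, IsSelfAdjoint (perturbed R D₁ D₂ E) := isSelfAdjoint_perturbed hRs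
  obtain ⟨ua, hua'⟩ := hua
  obtain ⟨ub, hub'⟩ := hub
  have hsa : ∀ w, shifted R a ((↑ua⁻¹ : H →L[ℂ] H) w) = w := fun w => by
    rw [← hua', ← mul_apply_eq_comp, Units.mul_inv]; rfl
  have hsb : ∀ w, shifted R b ((↑ub⁻¹ : H →L[ℂ] H) w) = w := fun w => by
    rw [← hub', ← mul_apply_eq_comp, Units.mul_inv]; rfl
  have hua := hF a ⟨le_rfl, hab⟩
  set P := negProj (shifted R a) with hP
  set Q := negProj (perturbed R D₁ D₂ a) with hQ
  have hPP : ∀ z, P (P z) = P z := fun z => by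
    rw [← mul_apply_eq_comp, hP, negProj_mul_self hua]
  have hQQ : ∀ z, Q (Q z) = Q z := fun z => by
    rw [← mul_apply_eq_comp, hQ, negProj_mul_self hG]
  -- F(a) and G(a) differ by a compact operator and 0 lies in neither spectrum, so the step function
  -- is continuous on both.
  have hQP : IsCompactOperator (Q - P) := by
    refine IsCompactOperator.cfc_sub_cfc (hGs a) (hFs a)
      (isCompactOperator_perturbed_sub_shifted hD₁ hD₂ a) ?_
    refine continuousOn_ite_neg ?_
    rintro (h | h)
    exacts [spectrum.zero_notMem ℝ hG h, spectrum.zero_notMem ℝ hua h]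
  let L₁ : H →L[ℂ] H := (↑ua⁻¹ : H →L[ℂ] H) ∘L D₁.adjoint ∘L D₁
  let L₂ : H →L[ℂ] H := (↑ub⁻¹ : H →L[ℂ] H) ∘L D₂.adjoint ∘L D₂
  have hL₁ : IsCompactOperator L₁ := (hD₁.clm_comp' _).clm_comp' _
  have hL₂ : IsCompactOperator L₂ := (hD₂.clm_comp' _).clm_comp' _
  have hqc : IsCompactOperator q := by
    have : q = V.subtypeL ∘L q.codRestrict V hqV := rfl
    rw [this]
    exact (IsCompactOperator.of_finiteDimensional_rng _).clm_comp' _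
  -- Y is the positive part of h for G(a). X is its negative part made R-orthogonal to V, plus a
  -- free vector of V. The vectors X and Y - X are never combined directly: each is corrected by its
  -- own Schur term, L₂ or L₁, and projected by P or 1 - P.
  let X : H × V →L[ℂ] H := ((1 - q) ∘L Q) ∘L ContinuousLinearMap.fst ℂ H V +
    V.subtypeL ∘L ContinuousLinearMap.snd ℂ H V
  let Y : H × V →L[ℂ] H := (1 - Q) ∘L ContinuousLinearMap.fst ℂ H V
  let Ψ : H × V →L[ℂ] H := (P ∘L (1 - L₂)) ∘L X + ((1 - P) ∘L (1 + L₁)) ∘L Y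
  let Φ : H × V →L[ℂ] M₁ × M₂ :=
    ((M₁.orthogonalProjectionOnto ∘L D₁) ∘L Y).prod ((M₂.orthogonalProjectionOnto ∘L D₂) ∘L X)
  rw [← Module.finrank_prod]
  refine finrank_le_of_injective_of_isCompactOperator_sub Ψ Φ ?_ ?_
  · have hPP' : P * P = P := negProj_mul_self hua
    -- The leading part is P Q + (1 - P)(1 - Q) = 1 + P (Q - P) - (1 - P)(Q - P); every other term
    -- contains L₁, L₂ or q.
    have : Ψ ∘L ContinuousLinearMap.inl ℂ H V - 1 =
        (P ∘L (Q - P) - (1 - P) ∘L (Q - P)) - (P ∘L L₂) ∘L ((1 - q) ∘L Q) - P ∘L (q ∘L Q) +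
          ((1 - P) ∘L L₁) ∘L (1 - Q) := by
      have : Ψ ∘L ContinuousLinearMap.inl ℂ H V =
          (P * (1 - L₂)) * ((1 - q) * Q) + ((1 - P) * (1 + L₁)) * (1 - Q) := by
        ext x; simp [Ψ, X, Y]; abel
      rw [this]
      simp only [← ContinuousLinearMap.mul_def, mul_sub, sub_mul, mul_add, add_mul, one_mul,
        mul_one, hPP', mul_assoc]
      abel
    rw [this]
    exact ((((hQP.clm_comp' _).sub' (hQP.clm_comp' _)).sub' ((hL₂.clm_comp' _).comp_clm' _)).sub'
      ((hqc.comp_clm' _).clm_comp' _)).add' ((hL₁.clm_comp' _).comp_clm' _)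
  · rintro ⟨h, v⟩ hΨ hΦ
    set x := X (h, v) with hx
    set y := Y (h, v) with hy
    have hΨ' : P (x - L₂ x) + (y + L₁ y - P (y + L₁ y)) = 0 := by
      have h0 : P (x - L₂ x) + ((y + L₁ y) - P (y + L₁ y)) = Ψ (h, v) := by
        simp only [Ψ, add_apply, ContinuousLinearMap.comp_apply, sub_apply, one_apply_eq_self,
          ← hx, ← hy]
      rw [h0, hΨ]
    have h1 : P (x - L₂ x) = 0 := by
      have := congrArg P hΨ'
      simpa [hPP] using this
    have h2 : P (y + L₁ y) = y + L₁ y := by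
      rw [h1, zero_add, sub_eq_zero] at hΨ'
      exact hΨ'.symm
    have hk₁ : D₁ y ∈ M₁ᗮ := by
      have : M₁.orthogonalProjectionOnto (D₁ y) = 0 := congrArg Prod.fst hΦ
      exact Submodule.orthogonalProjectionOnto_eq_zero_iff.1 this
    have hk₂ : D₂ x ∈ M₂ᗮ := by
      have : M₂.orthogonalProjectionOnto (D₂ x) = 0 := congrArg Prod.snd hΦ
      exact Submodule.orthogonalProjectionOnto_eq_zero_iff.1 this
    -- the component in the positive subspace
    have hQy : Q y = 0 := by simp [hy, Y, hQQ]
    have hy0 : y = 0 := by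
      by_contra hy0
      have e1 := inner_pos_of_negProj (hGs a) hG hQy hy0
      -- The square at y + L₁ y equals f(y) + 2‖D₁ y‖² + ⟪D₁ y, D₁ L₁ y⟫ with f the form of F(a).
      -- Off M₁ this is at least f(y) + ‖D₁ y‖², which is positive by e1, although y + L₁ y lies in
      -- ran P.
      have e2 := hM₁ _ hk₁ (L₁ y) (hsa _)
      have e3 := re_inner_add_smul (hFs a) D₁ (x := y) (y := L₁ y) (hsa _) 1
      have e4 : (⟪y + L₁ y, shifted R a (y + L₁ y)⟫_ℂ).re ≤ 0 := by
        by_cases h0 : y + L₁ y = 0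
        · simp [h0]
        · exact (inner_neg_of_negProj (hFs a) hua h2 h0).le
      rw [one_smul] at e3
      rw [re_inner_perturbed] at e1
      nlinarith [sq_nonneg ‖D₂ y‖]
    -- the component in the negative subspace
    have hxz : 0 ≤ (⟪x, perturbed R D₁ D₂ b x⟫_ℂ).re := by
      -- The same square with the opposite sign at b: x - L₂ x lies in ker P, where F(b) ≥ 0.
      have e2 := hM₂ _ hk₂ (L₂ x) (hsb _)
      have e3 := re_inner_add_smul (hFs b) D₂ (x := x) (y := L₂ x) (hsb _) (-1)
      have e4 : 0 ≤ (⟪x - L₂ x, shifted R b (x - L₂ x)⟫_ℂ).re :=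
        inner_shifted_nonneg hRs hab hF h1
      rw [neg_one_smul, ← sub_eq_add_neg] at e3
      rw [re_inner_perturbed]
      nlinarith [sq_nonneg ‖D₁ x‖]
    set w := Q h with hw
    have hxw : x = (w - q w) + v := by simp [hx, X, hw]
    -- G(E) maps V into R V, to which w - q w is orthogonal.
    have horth : ∀ E, ∀ u ∈ V, ⟪perturbed R D₁ D₂ E u, w - q w⟫_ℂ = 0 := by
      intro E u hu
      obtain ⟨u', hu', he⟩ := hV u hu
      rw [perturbed_apply_eq a E, he, inner_sub_left, hq u' hu', ← Complex.coe_smul,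
        inner_smul_left, hq u hu, mul_zero, sub_zero]
    have hw0 : w = 0 ∧ (v : H) = 0 := by
      -- With z = w - q w and g_E the form of G(E): g_b(x) = g_b(z) + g_b(v), and g_b(z) ≤ g_a(z) =
      -- g_a(w) - g_a(q w) ≤ g_a(w). Now g_a(w) < 0 unless w = 0 and g_b(v) < 0 unless v = 0, while
      -- g_b(x) ≥ 0.
      have e1 := re_inner_add_of_inner_eq_zero (hGs b) (horth b v v.2)
      rw [← hxw] at e1
      have e2 := re_inner_add_of_inner_eq_zero (hGs a) (horth a _ (hqV w))
      rw [sub_add_cancel] at e2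
      have e3 : (⟪w - q w, perturbed R D₁ D₂ b (w - q w)⟫_ℂ).re ≤
          (⟪w - q w, perturbed R D₁ D₂ a (w - q w)⟫_ℂ).re := by
        rw [perturbed_apply_eq a b, inner_sub_right, ← Complex.coe_smul, inner_smul_right,
          Complex.sub_re, Complex.re_ofReal_mul]
        have := mul_nonneg (sub_nonneg.2 hab) (re_inner_nonneg_of_nonneg hR (w - q w))
        linarith
      have e4 : 0 ≤ (⟪q w, perturbed R D₁ D₂ a (q w)⟫_ℂ).re := by
        by_cases h0 : q w = 0
        · simp [h0]
        · exact (hpos _ (hqV w) h0).le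
      have hw0 : w = 0 := by
        by_contra hw0
        have e5 := inner_neg_of_negProj (hGs a) hG (hQQ h) hw0
        have e6 : (⟪(v : H), perturbed R D₁ D₂ b v⟫_ℂ).re ≤ 0 := by
          by_cases h0 : (v : H) = 0
          · simp [h0]
          · exact (hneg _ v.2 h0).le
        linarith
      refine ⟨hw0, ?_⟩
      by_contra h0
      have := hneg _ v.2 h0
      rw [hw0] at e1
      simp at e1
      linarith
    have hh : h = 0 := by
      have : y = h - w := by simp [hy, Y, hw]
      rw [hy0, hw0.1, sub_zero] at this
      exact this.symm
    exact Prod.ext hh (Subtype.ext hw0.2)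

end Core

/-! ### Projection orthogonal for the form ⟪S ·, S ·⟫ -/

section Oblique

variable {H : Type*} [NormedAddCommGroup H] [InnerProductSpace ℂ H]

theorem finiteDimensional_comap {S : H →L[ℂ] H} (hinj : Function.Injective S) (W : Submodule ℂ H)
    [FiniteDimensional ℂ W] : FiniteDimensional ℂ (W.comap S.toLinearMap) :=
  FiniteDimensional.of_injective
    (S.toLinearMap.restrict (p := W.comap S.toLinearMap) (q := W) fun _ h => h)
    fun _ _ h => Subtype.ext (hinj (congrArg Subtype.val h))

variable [CompleteSpace H]

/-- The projection onto the finite-dimensional space `S⁻¹ W`, orthogonal for `⟪S ·, S ·⟫`. -/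
theorem exists_projection_comap {S : H →L[ℂ] H} (hS : IsSelfAdjoint S)
    (hinj : Function.Injective S) (W : Submodule ℂ H) [FiniteDimensional ℂ W]
    (hW : ∀ w ∈ W, ∃ x, S x = w) :
    ∃ q : H →L[ℂ] H, (∀ x, S (q x) ∈ W) ∧ ∀ v, S v ∈ W → ∀ x, ⟪(S * S) v, x - q x⟫_ℂ = 0 := by
  -- S is a bijection S⁻¹ W → W; the projection is q = S⁻¹ P_W S, with P_W the orthogonal projection
  -- onto W.
  let e : W.comap S.toLinearMap ≃ₗ[ℂ] W := LinearEquiv.ofBijective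
    (S.toLinearMap.restrict (p := W.comap S.toLinearMap) (q := W) fun _ h => h)
    ⟨fun x y h => Subtype.ext (hinj (congrArg Subtype.val h)), fun w => by
      obtain ⟨x, hx⟩ := hW w w.2
      exact ⟨⟨x, by simp [hx]⟩, Subtype.ext hx⟩⟩
  let f : W →L[ℂ] H :=
    LinearMap.toContinuousLinearMap ((W.comap S.toLinearMap).subtype ∘ₗ e.symm.toLinearMap)
  have hf : ∀ w, S (f w) = w := fun w => congrArg Subtype.val (e.apply_symm_apply w)
  refine ⟨f ∘L W.orthogonalProjectionOnto ∘L S, fun x => ?_, fun v hv x => ?_⟩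
  · simp [hf]
  · rw [mul_apply_eq_comp, ← hS.adjoint_eq, ContinuousLinearMap.adjoint_inner_left, hS.adjoint_eq,
      map_sub]
    simp only [ContinuousLinearMap.comp_apply, hf]
    exact (Submodule.mem_orthogonal _ _).1 (Submodule.sub_starProjection_mem_orthogonal (S x)) _ hv

end Oblique

/-! ### Upper spectral subspaces of bounded self-adjoint operators -/

section Spectral

variable {H : Type*} [NormedAddCommGroup H] [InnerProductSpace ℂ H] [CompleteSpace H]

/-- The spectral subspace of a bounded self-adjoint operator for `[c, ∞)`: the common kernel of
the `g(x)`, where `g` is continuous and vanishes on `[c, ∞)`. -/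
noncomputable def upperSubspace (x : H →L[ℂ] H) (c : ℝ) : Submodule ℂ H :=
  ⨅ g ∈ {g : ℝ → ℝ | Continuous g ∧ ∀ t, c ≤ t → g t = 0}, LinearMap.ker (cfc g x).toLinearMap

variable {x y : H →L[ℂ] H} {c d : ℝ}

theorem mem_upperSubspace {v : H} : v ∈ upperSubspace x c ↔
    ∀ g : ℝ → ℝ, Continuous g → (∀ t, c ≤ t → g t = 0) → cfc g x v = 0 := by
  simp [upperSubspace, Submodule.mem_iInf]

theorem upperSubspace_anti (h : c ≤ d) : upperSubspace x d ≤ upperSubspace x c := fun _ hv =>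
  mem_upperSubspace.2 fun g hg h0 => mem_upperSubspace.1 hv g hg fun t ht => h0 t (h.trans ht)

theorem apply_mem_upperSubspace (h : ℝ → ℝ) {v : H}
    (hv : v ∈ upperSubspace x c) : cfc h x v ∈ upperSubspace x c := by
  refine mem_upperSubspace.2 fun g hg h0 => ?_
  rw [← mul_apply_eq_comp, cfc_commute_cfc g h x, mul_apply_eq_comp, mem_upperSubspace.1 hv g hg h0,
    map_zero]

theorem range_cfc_le_upperSubspace {h : ℝ → ℝ} (hh : Continuous h) (h0 : ∀ t < c, h t = 0) :
    LinearMap.range (cfc h x).toLinearMap ≤ upperSubspace x c := by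
  rintro _ ⟨v, rfl⟩
  refine mem_upperSubspace.2 fun g hg hg0 => ?_
  have : cfc g x * cfc h x = 0 := by
    rw [← cfc_mul g h x hg.continuousOn hh.continuousOn, ← cfc_zero ℝ x]
    congr 1
    ext t
    rcases lt_or_ge t c with ht | ht
    · simp [h0 t ht]
    · simp [hg0 t ht]
  exact DFunLike.congr_fun this v

/-- If `y` is a compact perturbation of `x` with no spectrum above `d < c`, then the spectral
subspace of `x` for `[c, ∞)` is finite-dimensional. -/
theorem finiteDimensional_upperSubspace (hx : IsSelfAdjoint x) (hy : IsSelfAdjoint y)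
    (hxy : IsCompactOperator (x - y)) (hdc : d < c) (hspec : ∀ t ∈ spectrum ℝ y, t ≤ d) :
    FiniteDimensional ℂ (upperSubspace x c) := by
  -- A ramp from 0 at d to 1 at c: h(y) = 0 makes h(x) compact, and h(x) is the identity on the
  -- subspace, whose unit ball is thus relatively compact.
  let h : ℝ → ℝ := fun t => max 0 (min 1 ((t - d) / (c - d)))
  have hcont : Continuous h := by fun_prop
  have h0 : cfc h y = 0 := by
    rw [← cfc_zero ℝ y]
    refine cfc_congr fun t ht => ?_
    have : (t - d) / (c - d) ≤ 0 :=
      div_nonpos_of_nonpos_of_nonneg (sub_nonpos.2 (hspec t ht)) (sub_pos.2 hdc).le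
    simp only [h, Pi.zero_apply]
    exact max_eq_left ((min_le_right _ _).trans this)
  have hc : IsCompactOperator (cfc h x : H →L[ℂ] H) := by
    have := IsCompactOperator.cfc_sub_cfc hx hy hxy (f := h) hcont.continuousOn
    rwa [h0, sub_zero] at this
  have hfix : ∀ v ∈ upperSubspace x c, cfc h x v = v := fun v hv => by
    have := mem_upperSubspace.1 hv (fun t => 1 - h t) (by fun_prop) fun t ht => by
      have : 1 ≤ (t - d) / (c - d) := by rw [le_div_iff₀ (sub_pos.2 hdc)]; linarith
      simp [h, min_eq_left this]
    rw [cfc_sub (fun _ => (1 : ℝ)) h x continuousOn_const hcont.continuousOn,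
      cfc_const_one ℝ x, sub_apply, one_apply_eq_self, sub_eq_zero] at this
    exact this.symm
  have hclosed : IsClosed (upperSubspace x c : Set H) := by
    have : (upperSubspace x c : Set H) = ⋂ g ∈ {g : ℝ → ℝ | Continuous g ∧ ∀ t, c ≤ t → g t = 0},
        {v | cfc g x v = 0} := by
      ext v; simp [mem_upperSubspace]
    rw [this]
    exact isClosed_biInter fun g _ => isClosed_eq (cfc g x).continuous continuous_const
  have : CompleteSpace (upperSubspace x c) := hclosed.completeSpace_coe
  refine FiniteDimensional.of_isCompactOperator_id (𝕜 := ℂ) ?_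
  have h1 : IsCompactOperator ((cfc h x : H →L[ℂ] H) ∘ (upperSubspace x c).subtypeL) :=
    hc.comp_clm _
  have h2 := h1.codRestrict (V := upperSubspace x c) (fun v => by
    simp [hfix v v.2]) hclosed
  refine (congrArg IsCompactOperator (funext fun v => Subtype.ext ?_)).mp h2
  exact hfix v v.2

/-- The function (max t c)⁻¹ is continuous on ℝ and equals t⁻¹ on [c, ∞), so it inverts x on the
upper subspace. -/
theorem one_div_max_mul_fix (hx : IsSelfAdjoint x) (hc : 0 < c) {v : H}
    (hv : v ∈ upperSubspace x c) : x (cfc (fun t : ℝ => (max t c)⁻¹) x v) = v := by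
  have hpos : ∀ t : ℝ, max t c ≠ 0 := fun t => (hc.trans_le (le_max_right _ _)).ne'
  have hcont : Continuous fun t : ℝ => (max t c)⁻¹ := Continuous.inv₀ (by fun_prop) hpos
  have := mem_upperSubspace.1 hv (fun t => 1 - t * (max t c)⁻¹) (by fun_prop) fun t ht => by
    rw [max_eq_left ht, mul_inv_cancel₀ (hc.trans_le ht).ne', sub_self]
  rw [cfc_sub (fun _ => (1 : ℝ)) (fun t => t * (max t c)⁻¹) x continuousOn_const
      (by fun_prop), cfc_const_one ℝ x, cfc_mul (fun t => t) _ x (by fun_prop) hcont.continuousOn,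
      cfc_id' ℝ x, sub_apply, one_apply_eq_self, sub_eq_zero] at this
  exact this.symm

theorem inner_one_div_max_pos (hx : IsSelfAdjoint x) (hc : 0 < c) {v : H} (hv : v ≠ 0) :
    0 < (⟪v, cfc (fun t : ℝ => (max t c)⁻¹) x v⟫_ℂ).re := by
  have hpos : ∀ t : ℝ, 0 < max t c := fun t => hc.trans_le (le_max_right _ _)
  have hcont : Continuous fun t : ℝ => (max t c)⁻¹ :=
    Continuous.inv₀ (by fun_prop) fun t => (hpos t).ne'
  have hu : IsUnit (cfc (fun t : ℝ => (max t c)⁻¹) x) := by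
    rw [isUnit_cfc_iff _ _ hcont.continuousOn]
    exact fun t _ => (inv_pos.2 (hpos t)).ne'
  refine inner_pos_of_negProj (cfc_predicate _ _) hu ?_ hv
  have : negProj (cfc (fun t : ℝ => (max t c)⁻¹) x) = 0 := by
    rw [negProj, ← cfc_zero ℝ (cfc (fun t : ℝ => (max t c)⁻¹) x)]
    refine cfc_congr fun t ht => ?_
    rw [cfc_map_spectrum _ _ hx hcont.continuousOn] at ht
    obtain ⟨s, -, rfl⟩ := ht
    exact if_neg (inv_pos.2 (hpos s)).not_gt
  rw [this]; rfl

theorem inner_one_div_max_le (hx : IsSelfAdjoint x) (hc : 0 < c) (v : H) :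
    (⟪v, cfc (fun t : ℝ => (max t c)⁻¹) x v⟫_ℂ).re ≤ c⁻¹ * ‖v‖ ^ 2 := by
  have hpos : ∀ t : ℝ, 0 < max t c := fun t => hc.trans_le (le_max_right _ _)
  have hcont : Continuous fun t : ℝ => (max t c)⁻¹ :=
    Continuous.inv₀ (by fun_prop) fun t => (hpos t).ne'
  have h := re_inner_nonneg_of_nonneg (cfc_nonneg (a := x) (f := fun t : ℝ => c⁻¹ - (max t c)⁻¹)
    fun t _ => sub_nonneg.2 (inv_anti₀ hc (le_max_right _ _))) v
  rw [cfc_sub (fun _ => c⁻¹) _ x continuousOn_const hcont.continuousOn, cfc_const _ _ hx,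
    sub_apply, inner_sub_right, Complex.sub_re, Algebra.algebraMap_eq_smul_one, smul_apply,
    one_apply_eq_self, inner_smul_right_eq_smul, Complex.smul_re] at h
  rw [← inner_self_eq_norm_sq (𝕜 := ℂ)]
  exact sub_nonneg.1 h

end Spectral

end SpectralGap

namespace GapBound

/-! ### Resolvent identities and spectral gaps -/

section Resolvent

variable {H : Type*} [NormedAddCommGroup H] [InnerProductSpace ℂ H] {A : H →ₗ.[ℂ] H} {z : ℂ}

theorem isResolvent_iff_graph {R : H →L[ℂ] H} : IsResolvent A z R ↔
    (∀ x, (R x, x + z • R x) ∈ A.graph) ∧ ∀ p ∈ A.graph, R (p.2 - z • p.1) = p.1 := by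
  constructor
  · rintro ⟨h1, h2⟩
    refine ⟨fun x => ?_, fun p hp => ?_⟩
    · obtain ⟨h, hx⟩ := h1 x
      exact (LinearPMap.mem_graph_iff A).2 ⟨⟨R x, h⟩, rfl, sub_eq_iff_eq_add.1 hx⟩
    · obtain ⟨y, hy1, hy2⟩ := (LinearPMap.mem_graph_iff A).1 hp
      rw [← hy1, ← hy2, h2]
  · rintro ⟨h1, h2⟩
    refine ⟨fun x => ?_, fun y => h2 _ (LinearPMap.mem_graph A y)⟩
    obtain ⟨y, hy1, hy2⟩ := (LinearPMap.mem_graph_iff A).1 (h1 x)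
    simp only at hy1 hy2
    refine ⟨hy1 ▸ y.2, ?_⟩
    have : (⟨R x, hy1 ▸ y.2⟩ : A.domain) = y := Subtype.ext hy1.symm
    rw [this, hy2, add_sub_cancel_right]

namespace IsResolvent

theorem unique {R R' : H →L[ℂ] H} (h : IsResolvent A z R) (h' : IsResolvent A z R') : R = R' := by
  ext x
  have := (isResolvent_iff_graph.1 h').2 _ ((isResolvent_iff_graph.1 h).1 x)
  simpa using this.symm

theorem resolvent_eq {R : H →L[ℂ] H} (h : IsResolvent A z R) : resolvent A z = R := by
  have hex : ∃ R, IsResolvent A z R := ⟨R, h⟩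
  rw [resolvent, dif_pos hex]
  exact hex.choose_spec.unique h

theorem of_notMem_spectrum (h : z ∉ spectrum A) : IsResolvent A z (resolvent A z) := by
  have hex : ∃ R, IsResolvent A z R := not_not.1 h
  rw [resolvent, dif_pos hex]
  exact hex.choose_spec

theorem injective {R : H →L[ℂ] H} (h : IsResolvent A z R) {x : H} (hx : R x = 0) : x = 0 := by
  have h1 := (isResolvent_iff_graph.1 h).1 x
  rw [hx, smul_zero, add_zero] at h1
  exact A.graph_fst_eq_zero_snd h1 rfl

theorem sub_eq {w : ℂ} {R R' : H →L[ℂ] H} (h : IsResolvent A z R) (h' : IsResolvent A w R') :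
    R' = R + (w - z) • (R * R') := by
  ext x
  have := (isResolvent_iff_graph.1 h).2 _ ((isResolvent_iff_graph.1 h').1 x)
  simp only [map_sub, map_add, map_smul] at this
  change R' x = R x + (w - z) • R (R' x)
  linear_combination (norm := module) -this

theorem mul_eq_one {w : ℂ} {R R' : H →L[ℂ] H} (h : IsResolvent A z R) (h' : IsResolvent A w R') :
    (1 - (w - z) • R) * (1 + (w - z) • R') = 1 := by
  have e : (1 - (w - z) • R) * (1 + (w - z) • R') =
      1 + (w - z) • R' - (w - z) • (R + (w - z) • (R * R')) := by
    simp only [sub_mul, mul_add, smul_mul_assoc, mul_smul_comm, one_mul, mul_one, smul_add,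
      smul_sub]
    abel
  rw [e, ← h.sub_eq h', add_sub_cancel_right]

/-- First resolvent identity: `1 - (w - z) (A - z)⁻¹` is invertible for `w ∉ σ(A)`. -/
theorem isUnit_one_sub {w : ℂ} {R R' : H →L[ℂ] H} (h : IsResolvent A z R)
    (h' : IsResolvent A w R') : IsUnit (1 - (w - z) • R) := by
  refine ⟨⟨1 - (w - z) • R, 1 + (w - z) • R', h.mul_eq_one h', ?_⟩, rfl⟩
  have := h'.mul_eq_one h
  rw [← neg_sub w z, neg_smul, neg_smul, sub_neg_eq_add, ← sub_eq_add_neg] at this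
  exact this

/-- Since A - w = (1 - (w - z) R)(A - z) on D(A), inverting the bounded factor inverts A - w; R
commutes with W. -/
theorem mul_inv {w : ℂ} {R W : H →L[ℂ] H} (h : IsResolvent A z R)
    (h1 : (1 - (w - z) • R) * W = 1) (h2 : W * (1 - (w - z) • R) = 1) :
    IsResolvent A w (R * W) := by
  have hcomm : R * W = W * R := by
    have e : (1 - (w - z) • R) * R = R * (1 - (w - z) • R) := by
      simp [sub_mul, mul_sub]
    calc R * W = W * (1 - (w - z) • R) * (R * W) := by rw [h2, one_mul]
      _ = W * ((1 - (w - z) • R) * R) * W := by simp only [mul_assoc]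
      _ = W * R * ((1 - (w - z) • R) * W) := by rw [e]; simp only [mul_assoc]
      _ = W * R := by rw [h1, mul_one]
  rw [isResolvent_iff_graph] at h ⊢
  refine ⟨fun x => ?_, fun p hp => ?_⟩
  · have := h.1 (W x)
    have hx : W x - (w - z) • R (W x) = x := DFunLike.congr_fun h1 x
    rw [mul_apply_eq_comp]
    convert this using 2
    nth_rewrite 1 [← hx]
    module
  · have h3 := h.2 p hp
    have h4 : R (p.2 - w • p.1) = p.1 - (w - z) • R p.1 := by
      rw [map_sub, map_smul] at h3 ⊢
      nth_rewrite 2 [← h3]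
      module
    rw [hcomm, mul_apply_eq_comp, h4]
    exact DFunLike.congr_fun h2 p.1

end IsResolvent

/-- In a gap `[α, β]` of `A`, the spectrum of `(A - α)⁻¹` lies below `(β - α)⁻¹`. -/
theorem spectrum_resolvent_le {α β : ℝ} (hαβ : α < β)
    (hgap : ∀ E ∈ Set.Icc α β, (E : ℂ) ∉ spectrum A) {x : H →L[ℂ] H} (hx : IsResolvent A α x)
    {t : ℝ} (ht : t ∈ _root_.spectrum ℝ x) : t ≤ (β - α)⁻¹ := by
  by_contra! hlt
  have hd : 0 < β - α := sub_pos.2 hαβ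
  have ht0 : 0 < t := (inv_pos.2 hd).trans hlt
  -- Under λ ↦ (λ - α)⁻¹ the value t comes from λ = α + t⁻¹, which lies in the gap.
  have hE : α + t⁻¹ ∈ Set.Icc α β := by
    have := inv_strictAnti₀ (inv_pos.2 hd) hlt
    rw [inv_inv] at this
    exact ⟨by linarith [inv_pos.2 ht0], by linarith⟩
  have hu := hx.isUnit_one_sub (IsResolvent.of_notMem_spectrum (hgap _ hE))
  refine ht (_root_.spectrum.mem_resolventSet_iff.2 ?_)
  have h1 : algebraMap ℝ (H →L[ℂ] H) t - x =
      algebraMap ℝ (H →L[ℂ] H) t * (1 - (((α + t⁻¹ : ℝ) : ℂ) - (α : ℂ)) • x) := by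
    rw [← Complex.ofReal_sub, add_sub_cancel_left, Complex.coe_smul, mul_sub, mul_one,
      ← Algebra.smul_def, smul_smul, mul_inv_cancel₀ ht0.ne', one_smul]
  rw [h1]
  exact ((isUnit_iff_ne_zero.2 ht0.ne').map (algebraMap ℝ (H →L[ℂ] H))).mul hu

end Resolvent

/-! ### Semibounded self-adjoint operators -/

section SelfAdjoint

variable {H : Type*} [NormedAddCommGroup H] [InnerProductSpace ℂ H] {A : H →ₗ.[ℂ] H}

theorem isLowerBound_lowerBound (h : IsSemibounded A) : IsLowerBound A (lowerBound A) := by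
  intro x
  by_cases hx : (x : H) = 0
  · simp [hx]
  · have hpos : 0 < ‖(x : H)‖ ^ 2 := pow_pos (norm_pos_iff.2 hx) 2
    rw [← le_div_iff₀ hpos]
    exact csSup_le h fun m hm => (le_div_iff₀ hpos).2 (hm x)

variable [CompleteSpace H]

theorem inner_apply_comm (hA : IsSelfAdjoint A) (x y : A.domain) :
    ⟪A x, (y : H)⟫_ℂ = ⟪(x : H), A y⟫_ℂ := by
  have h := LinearPMap.adjoint_isFormalAdjoint hA.dense_domain
  rw [LinearPMap.isSelfAdjoint_def.1 hA] at h
  exact h x y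

/-- Coercivity bounds A - e from below on the closed graph, so its range is closed; self-adjointness
makes the range dense. Coercivity also gives positivity of the inverse. -/
theorem exists_isResolvent (hA : IsSelfAdjoint A) {m e : ℝ} (hm : IsLowerBound A m) (he : e < m) :
    ∃ R : H →L[ℂ] H, IsResolvent A e R ∧ 0 ≤ R := by
  have hcoer : ∀ x : A.domain,
      (m - e) * ‖(x : H)‖ ^ 2 ≤ (⟪(x : H), A x - (e : ℂ) • (x : H)⟫_ℂ).re := by
    intro x
    have h1 := hm x
    have h2 : (⟪(x : H), (e : ℂ) • (x : H)⟫_ℂ).re = e * ‖(x : H)‖ ^ 2 := by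
      rw [inner_smul_right, Complex.re_ofReal_mul, ← inner_self_eq_norm_sq (𝕜 := ℂ)]; rfl
    rw [inner_sub_right, Complex.sub_re, h2]
    linarith
  have hbound : ∀ x : A.domain, (m - e) * ‖(x : H)‖ ≤ ‖A x - (e : ℂ) • (x : H)‖ := by
    intro x
    by_cases hx : (x : H) = 0
    · simp [hx]
    · have h1 := (hcoer x).trans ((Complex.re_le_norm _).trans (norm_inner_le_norm _ _))
      rw [pow_two, ← mul_assoc, mul_comm ‖(x : H)‖ ‖A x - _‖] at h1
      exact le_of_mul_le_mul_right h1 (norm_pos_iff.2 hx)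
  have hme : 0 < m - e := sub_pos.2 he
  let Γ := A.graph
  have hΓc : IsClosed (Γ : Set (H × H)) := hA.isClosed
  have : CompleteSpace Γ := hΓc.completeSpace_coe
  let f : Γ →L[ℂ] H := (ContinuousLinearMap.snd ℂ H H - (e : ℂ) • ContinuousLinearMap.fst ℂ H H) ∘L
    Γ.subtypeL
  have hf : ∀ p : Γ, f p = p.1.2 - (e : ℂ) • p.1.1 := fun p => rfl
  have hfb : ∀ p : Γ, (m - e) * ‖p.1.1‖ ≤ ‖f p‖ := fun p => by
    obtain ⟨x, hx1, hx2⟩ := (LinearPMap.mem_graph_iff A).1 p.2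
    rw [hf, ← hx1, ← hx2]; exact hbound x
  have hanti : ∃ C, AntilipschitzWith C f := by
    rw [antilipschitzWith_iff_exists_mul_le_norm]
    refine ⟨(1 + (1 + |e|) / (m - e))⁻¹, by positivity, fun p => ?_⟩
    rw [inv_mul_le_iff₀ (by positivity)]
    have h1 : ‖p.1.1‖ ≤ ‖f p‖ / (m - e) := by
      rw [le_div_iff₀ hme, mul_comm]; exact hfb p
    have h2 : ‖p.1.2‖ ≤ ‖f p‖ + |e| * ‖p.1.1‖ := by
      have : p.1.2 = f p + (e : ℂ) • p.1.1 := by rw [hf]; abel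
      calc ‖p.1.2‖ = ‖f p + (e : ℂ) • p.1.1‖ := by rw [← this]
        _ ≤ _ := (norm_add_le _ _).trans (by rw [norm_smul, Complex.norm_real, Real.norm_eq_abs])
    have h3 : ‖p‖ ≤ ‖p.1.1‖ + ‖p.1.2‖ :=
      max_le (le_add_of_nonneg_right (norm_nonneg _)) (le_add_of_nonneg_left (norm_nonneg _))
    have h4 : (1 + (1 + |e|) / (m - e)) * ‖f p‖ =
      ‖f p‖ + (1 + |e|) * (‖f p‖ / (m - e)) := by ring
    have h5 := mul_le_mul_of_nonneg_left h1 (add_nonneg zero_le_one (abs_nonneg e))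
    linarith
  obtain ⟨C, hC⟩ := hanti
  have hclosed : IsClosed (LinearMap.range f.toLinearMap : Set H) := by
    have h := hC.isClosed_range f.uniformContinuous
    change IsClosed (Set.range f)
    exact h
  have hsurj : LinearMap.range f.toLinearMap = ⊤ := by
    have : CompleteSpace (LinearMap.range f.toLinearMap) := hclosed.completeSpace_coe
    rw [← Submodule.orthogonal_eq_bot_iff, Submodule.eq_bot_iff]
    intro w hw
    -- A vector w orthogonal to the range satisfies A* w = e w, so A w = e w, and the lower bound
    -- gives w = 0.
    have hw' : ∀ x : A.domain, ⟪(e : ℂ) • w, (x : H)⟫_ℂ = ⟪w, A x⟫_ℂ := fun x => by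
      have h := (Submodule.mem_orthogonal' _ _).1 hw _
        ⟨⟨_, LinearPMap.mem_graph A x⟩, rfl⟩
      change ⟪w, A x - (e : ℂ) • (x : H)⟫_ℂ = 0 at h
      rw [inner_sub_right, sub_eq_zero, inner_smul_right] at h
      rw [h, inner_smul_left, Complex.conj_ofReal]
    have hmem := LinearPMap.mem_adjoint_domain_of_exists w ⟨_, hw'⟩
    have happ := LinearPMap.adjoint_apply_eq hA.dense_domain ⟨w, hmem⟩ hw'
    have hg : (w, (e : ℂ) • w) ∈ A.graph := by
      rw [← LinearPMap.isSelfAdjoint_def.1 hA, ← happ]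
      exact LinearPMap.mem_graph A.adjoint ⟨w, hmem⟩
    have := hfb ⟨_, hg⟩
    rw [hf] at this
    simp only [sub_self, norm_zero] at this
    exact norm_le_zero_iff.1 (le_of_mul_le_mul_left (by simpa using this) hme)
  let g := ContinuousLinearEquiv.ofBijective f (LinearMap.ker_eq_bot.2 hC.injective) hsurj
  let R : H →L[ℂ] H := ContinuousLinearMap.fst ℂ H H ∘L Γ.subtypeL ∘L (g.symm : H →L[ℂ] Γ)
  have hgR : ∀ x, (R x, x + (e : ℂ) • R x) ∈ A.graph := fun x => by
    have h1 : f (g.symm x) = x := g.apply_symm_apply x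
    have h2 : x + (e : ℂ) • R x = (g.symm x).1.2 := by
      nth_rewrite 1 [← h1]
      rw [hf]
      exact sub_add_cancel _ _
    rw [h2]
    exact (g.symm x).2
  have hres : IsResolvent A e R := isResolvent_iff_graph.2 ⟨hgR, fun p hp => by
    have : g.symm (p.2 - (e : ℂ) • p.1) = ⟨p, hp⟩ := g.symm_apply_apply ⟨p, hp⟩
    change (g.symm (p.2 - (e : ℂ) • p.1)).1.1 = _
    rw [this]⟩
  refine ⟨R, hres, (ContinuousLinearMap.nonneg_iff_isPositive R).2 ⟨fun x y => ?_, fun x => ?_⟩⟩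
  · obtain ⟨hx, hx'⟩ := hres.1 x
    obtain ⟨hy, hy'⟩ := hres.1 y
    have := inner_apply_comm hA ⟨R x, hx⟩ ⟨R y, hy⟩
    change ⟪R x, y⟫_ℂ = ⟪x, R y⟫_ℂ
    nth_rewrite 2 [← hx']
    nth_rewrite 1 [← hy']
    rw [inner_sub_left, inner_sub_right, this, inner_smul_left, inner_smul_right,
      Complex.conj_ofReal]
  · obtain ⟨hx, hx'⟩ := hres.1 x
    have h1 := hcoer ⟨R x, hx⟩
    rw [hx'] at h1
    rw [ContinuousLinearMap.reApplyInnerSelf_apply]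
    exact (mul_nonneg hme.le (sq_nonneg _)).trans h1

end SelfAdjoint

/-! ### Functional calculus of unbounded operators through bounded ones -/

section FuncCalc

variable {H : Type*} [NormedAddCommGroup H] [InnerProductSpace ℂ H] [CompleteSpace H]

open Classical in
/-- If `(T - i)⁻¹ = φ(x)` for a bounded self-adjoint `x`, then `f(T) = h(x)`, where
`h = f ∘ (φ⁻¹ + i)`. -/
theorem funcCalc_eq_cfc {T : H →ₗ.[ℂ] H} {x : H →L[ℂ] H} (hx : IsSelfAdjoint x) {φ : ℂ → ℂ}
    {ψ : ℂ → ℝ} (hres : resolvent T Complex.I = cfc φ x)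
    (hφ : ContinuousOn φ (_root_.spectrum ℂ x))
    (hψ : ContinuousOn ψ (φ '' _root_.spectrum ℂ x))
    (hψφ : ∀ t : ℝ, (t : ℂ) ∈ _root_.spectrum ℂ x → ψ (φ t) = t) {f h : ℝ → ℝ} (hh : Continuous h)
    (hfh : ∀ t : ℝ, (t : ℂ) ∈ _root_.spectrum ℂ x →
      (if φ t = 0 then 0 else f ((φ t)⁻¹ + Complex.I).re) = h t) :
    funcCalc T f = cfc h x := by
  have hreal : ∀ z ∈ _root_.spectrum ℂ x, ∃ t : ℝ, z = t := fun z hz =>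
    ⟨z.re, (hx.mem_spectrum_eq_re hz)⟩
  have key : ∀ z ∈ _root_.spectrum ℂ x,
      (if φ z = 0 then 0 else ((f ((φ z)⁻¹ + Complex.I).re : ℝ) : ℂ)) = (h z.re : ℂ) := by
    intro z hz
    obtain ⟨t, rfl⟩ := hreal z hz
    rw [Complex.ofReal_re, ← hfh t hz]
    split_ifs <;> simp
  -- Continuity at z = 0, the image of λ = ∞, is inherited from h through the inverse ψ of φ.
  have hg : ContinuousOn (fun z : ℂ => if z = 0 then 0 else ((f (z⁻¹ + Complex.I).re : ℝ) : ℂ))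
      (φ '' _root_.spectrum ℂ x) := by
    refine ContinuousOn.congr (f := fun z => (h (ψ z) : ℂ))
      (Complex.continuous_ofReal.comp_continuousOn (hh.comp_continuousOn hψ)) ?_
    rintro _ ⟨z, hz, rfl⟩
    have := key z hz
    obtain ⟨t, rfl⟩ := hreal z hz
    simp only [this, hψφ t hz, Complex.ofReal_re]
  rw [funcCalc, hres, ← cfc_comp' _ φ x hg hφ hx.isStarNormal, cfc_real_eq_complex h hx]
  exact cfc_congr key

/-- The functional calculus of an operator, in terms of its resolvent at a real point. -/
theorem funcCalc_eq_cfc_resolvent {T : H →ₗ.[ℂ] H} {a : ℝ} {x : H →L[ℂ] H} (hx : IsSelfAdjoint x)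
    (hT : IsResolvent T a x) {f h : ℝ → ℝ} (hh : Continuous h) (h0 : h 0 = 0)
    (hfh : ∀ t ≠ 0, h t = f (t⁻¹ + a)) : funcCalc T f = cfc h x := by
  -- The denominator in (T - i)⁻¹ = x (1 - (i - a) x)⁻¹; it has no real zero.
  let d : ℂ → ℂ := fun z => 1 - (Complex.I - a) * z
  have hd : ∀ t : ℝ, d t ≠ 0 := by
    intro t h
    have h1 := congrArg Complex.im h
    have h2 := congrArg Complex.re h
    simp [d] at h1 h2
    rw [h1] at h2
    simp at h2
  have hreal : ∀ z ∈ _root_.spectrum ℂ x, ∃ t : ℝ, z = t := fun z hz =>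
    ⟨z.re, (hx.mem_spectrum_eq_re hz)⟩
  have hd' : ∀ z ∈ _root_.spectrum ℂ x, d z ≠ 0 := fun z hz => by
    obtain ⟨t, rfl⟩ := hreal z hz; exact hd t
  have hdc : ContinuousOn d (_root_.spectrum ℂ x) := by fun_prop
  have hdi : ContinuousOn (fun z => (d z)⁻¹) (_root_.spectrum ℂ x) := hdc.inv₀ hd'
  have hn : IsStarNormal x := hx.isStarNormal
  have hdx : cfc d x = 1 - (Complex.I - a) • x := by
    rw [cfc_sub (fun _ => (1 : ℂ)) _ x, cfc_const_one ℂ x, cfc_const_mul_id _ x]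
  have hmul : cfc d x * cfc (fun z => (d z)⁻¹) x = 1 := by
    rw [← cfc_mul d _ x hdc hdi, ← cfc_const_one ℂ x]
    exact cfc_congr fun z hz => mul_inv_cancel₀ (hd' z hz)
  have hmul' : cfc (fun z => (d z)⁻¹) x * cfc d x = 1 := by
    rw [← cfc_mul _ d x hdi hdc, ← cfc_const_one ℂ x]
    exact cfc_congr fun z hz => inv_mul_cancel₀ (hd' z hz)
  rw [hdx] at hmul hmul'
  have hres := (hT.mul_inv hmul hmul').resolvent_eq
  have hres' : resolvent T Complex.I = cfc (fun z => z * (d z)⁻¹) x := by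
    rw [hres, cfc_mul (fun z => z) _ x (by fun_prop) hdi, cfc_id' ℂ x]
  have hinv : ∀ t : ℝ, t ≠ 0 → ((t : ℂ) * (d t)⁻¹)⁻¹ = (t : ℂ)⁻¹ - (Complex.I - a) := by
    intro t ht
    have : (t : ℂ) ≠ 0 := Complex.ofReal_ne_zero.2 ht
    rw [mul_inv, inv_inv]
    simp only [d]
    field_simp
  have hden : ∀ t : ℝ, 1 + (Complex.I - a) * ((t : ℂ) * (d t)⁻¹) = (d t)⁻¹ := by
    intro t
    have := hd t
    have e : 1 = d t * (d t)⁻¹ := (mul_inv_cancel₀ this).symm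
    nth_rewrite 1 [e]
    simp only [d]
    ring
  refine funcCalc_eq_cfc hx (ψ := fun w => (w / (1 + (Complex.I - a) * w)).re) hres'
    (continuousOn_id.mul hdi) ?_ (fun t _ => ?_) hh (fun t _ => ?_)
  · refine Complex.continuous_re.comp_continuousOn (continuousOn_id.div (by fun_prop) ?_)
    rintro _ ⟨z, hz, rfl⟩
    obtain ⟨t, rfl⟩ := hreal z hz
    simp only [hden]
    exact inv_ne_zero (hd t)
  · simp only [hden]
    rw [div_inv_eq_mul, mul_assoc, inv_mul_cancel₀ (hd t), mul_one, Complex.ofReal_re]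
  · by_cases ht : t = 0
    · simp [ht, h0]
    · have : (t : ℂ) * (d t)⁻¹ ≠ 0 :=
        mul_ne_zero (Complex.ofReal_ne_zero.2 ht) (inv_ne_zero (hd t))
      rw [if_neg this, hinv t ht, hfh t ht]
      congr 1
      rw [← Complex.ofReal_inv]
      simp

/-- The functional calculus of a bounded self-adjoint operator. -/
theorem funcCalc_eq_cfc_of_graph {T : H →ₗ.[ℂ] H} {x : H →L[ℂ] H} (hx : IsSelfAdjoint x)
    (hT : ∀ p, p ∈ T.graph ↔ x p.1 = p.2) {f : ℝ → ℝ} (hf : Continuous f) :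
    funcCalc T f = cfc f x := by
  have hreal : ∀ z ∈ _root_.spectrum ℂ x, ∃ t : ℝ, z = t := fun z hz =>
    ⟨z.re, (hx.mem_spectrum_eq_re hz)⟩
  have hd : ∀ t : ℝ, (t : ℂ) - Complex.I ≠ 0 := fun t h => by
    have := congrArg Complex.im h
    simp at this
  have hd' : ∀ z ∈ _root_.spectrum ℂ x, z - Complex.I ≠ 0 := fun z hz => by
    obtain ⟨t, rfl⟩ := hreal z hz; exact hd t
  have hdc : ContinuousOn (fun z => z - Complex.I) (_root_.spectrum ℂ x) := by fun_prop
  have hdi : ContinuousOn (fun z => (z - Complex.I)⁻¹) (_root_.spectrum ℂ x) := hdc.inv₀ hd'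
  have hn : IsStarNormal x := hx.isStarNormal
  have hdx : cfc (fun z => z - Complex.I) x = x - Complex.I • 1 := by
    rw [cfc_sub (fun z => z) (fun _ => Complex.I) x, cfc_id' ℂ x, cfc_const Complex.I x,
      Algebra.algebraMap_eq_smul_one]
  have hmul : cfc (fun z => z - Complex.I) x * cfc (fun z => (z - Complex.I)⁻¹) x = 1 := by
    rw [← cfc_mul _ _ x hdc hdi, ← cfc_const_one ℂ x]
    exact cfc_congr fun z hz => mul_inv_cancel₀ (hd' z hz)
  have hmul' : cfc (fun z => (z - Complex.I)⁻¹) x * cfc (fun z => z - Complex.I) x = 1 := by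
    rw [← cfc_mul _ _ x hdi hdc, ← cfc_const_one ℂ x]
    exact cfc_congr fun z hz => inv_mul_cancel₀ (hd' z hz)
  rw [hdx] at hmul hmul'
  have hres : IsResolvent T Complex.I (cfc (fun z => (z - Complex.I)⁻¹) x) := by
    refine isResolvent_iff_graph.2 ⟨fun y => ?_, fun p hp => ?_⟩
    · rw [hT]
      exact sub_eq_iff_eq_add.1 (DFunLike.congr_fun hmul y)
    · rw [← (hT p).1 hp]
      exact DFunLike.congr_fun hmul' p.1
  refine funcCalc_eq_cfc hx (ψ := fun w => (w⁻¹ + Complex.I).re) hres.resolvent_eq hdi ?_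
    (fun t _ => by simp) hf (fun t _ => ?_)
  · refine Complex.continuous_re.comp_continuousOn
      ((continuousOn_id.inv₀ ?_).add continuousOn_const)
    rintro _ ⟨z, hz, rfl⟩
    exact inv_ne_zero (hd' z hz)
  · rw [if_neg (inv_ne_zero (hd t))]
    simp

variable {T : H →ₗ.[ℂ] H} {x : H →L[ℂ] H}

theorem inner_cfc_eq_zero_of_mem_orthogonal (hx : IsSelfAdjoint x)
    (hT : ∀ p, p ∈ T.graph ↔ x p.1 = p.2) {U : Set ℝ} {k : H} (hk : k ∈ (spectralSubspace T U)ᗮ)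
    {f g : ℝ → ℝ} (hf : Continuous f) (hfc : HasCompactSupport f) (hfU : tsupport f ⊆ U)
    (hfg : ∀ t ∈ _root_.spectrum ℝ x, f t = g t) : ⟪k, cfc g x k⟫_ℂ = 0 := by
  rw [← cfc_congr hfg, ← funcCalc_eq_cfc_of_graph hx hT hf]
  refine (Submodule.mem_orthogonal' _ _).1 hk _ (Submodule.le_topologicalClosure _ ?_)
  exact Submodule.mem_iSup_of_mem f (Submodule.mem_iSup_of_mem ⟨hf, hfc, hfU⟩ ⟨k, rfl⟩)

/-- On the orthogonal complement of the spectral subspace of a bounded self-adjoint operator for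
an open set containing `{t | c < s t}`, where `s = ± 1`, the quadratic form of `s T` is at most
`c`. -/
theorem mul_re_inner_le_of_mem_orthogonal (hx : IsSelfAdjoint x)
    (hT : ∀ p, p ∈ T.graph ↔ x p.1 = p.2) {s c : ℝ} (hs : |s| = 1) {U : Set ℝ}
    (hU : ∀ t, c < s * t → t ∈ U) {k : H} (hk : k ∈ (spectralSubspace T U)ᗮ) :
    s * (⟪k, x k⟫_ℂ).re ≤ c * ‖k‖ ^ 2 := by
  obtain ⟨M, hM⟩ := (_root_.spectrum.isCompact (𝕜 := ℝ) x).isBounded.subset_closedBall 0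
  have key : ∀ ε > 0, s * (⟪k, x k⟫_ℂ).re ≤ (c + ε) * ‖k‖ ^ 2 := by
    intro ε hε
    -- A tent supported in s t ≥ c + ε, wide enough that f(t) ≥ s t - (c + ε) on the spectrum. The
    -- margin ε keeps its closed support inside U, so ⟪k, f(x) k⟫ = 0.
    let f : ℝ → ℝ :=
      fun t => max 0 (min (s * t - (c + ε)) ((c + ε) + 2 * (|M| + |c + ε|) - s * t))
    let I : Set ℝ := {t | s * t ∈ Set.Icc (c + ε) ((c + ε) + 2 * (|M| + |c + ε|))}
    have hfcont : Continuous f := by fun_prop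
    have hI : IsClosed I := isClosed_Icc.preimage (by fun_prop)
    have hIc : IsCompact I := by
      refine Metric.isCompact_of_isClosed_isBounded hI
        ((Metric.isBounded_closedBall (x := (0 : ℝ))
          (r := |c + ε| + |(c + ε) + 2 * (|M| + |c + ε|)|)).subset fun t ht => ?_)
      rw [mem_closedBall_zero_iff, Real.norm_eq_abs, ← one_mul |t|, ← hs, ← abs_mul]
      refine (abs_le_max_abs_abs ht.1 ht.2).trans (max_le ?_ ?_)
      · exact le_add_of_nonneg_right (abs_nonneg _)
      · exact le_add_of_nonneg_left (abs_nonneg _)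
    have hsupp : Function.support f ⊆ I := by
      intro t ht
      by_contra hn
      refine ht (max_eq_left ?_)
      rw [Set.mem_ofPred_eq, Set.mem_Icc, not_and_or, not_le, not_le] at hn
      rcases hn with hn | hn
      · exact (min_le_left _ _).trans (by linarith)
      · exact (min_le_right _ _).trans (by linarith)
    have hts : tsupport f ⊆ I := closure_minimal hsupp hI
    have h0 := inner_cfc_eq_zero_of_mem_orthogonal hx hT hk hfcont
      (HasCompactSupport.intro hIc fun t ht => by
        by_contra h; exact ht (hsupp h))
      (fun t ht => hU t (lt_of_lt_of_le (by linarith) (hts ht).1)) (g := f) fun _ _ => rfl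
    have h1 := SpectralGap.re_inner_nonneg_of_nonneg (cfc_nonneg (a := x)
      (f := fun t : ℝ => f t - (s * t - (c + ε))) fun t ht => by
        have h2 : s * t ≤ |M| := by
          have := hM ht
          rw [mem_closedBall_zero_iff, Real.norm_eq_abs, ← one_mul |t|, ← hs, ← abs_mul] at this
          exact (le_abs_self _).trans (this.trans (le_abs_self M))
        have h3 := neg_abs_le (c + ε)
        have h4 : s * t - (c + ε) ≤ f t :=
          (le_min le_rfl (by have := abs_nonneg M; linarith)).trans (le_max_right _ _)
        linarith) k
    rw [cfc_sub f _ x hfcont.continuousOn (by fun_prop),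
      cfc_sub (fun t => s * t) (fun _ => c + ε) x, cfc_const_mul_id s x, cfc_const _ _ hx,
      sub_apply, sub_apply, inner_sub_right, h0, inner_sub_right, Algebra.algebraMap_eq_smul_one,
      smul_apply, smul_apply, one_apply_eq_self, inner_smul_right_eq_smul,
      inner_smul_right_eq_smul, zero_sub, neg_sub, Complex.sub_re, Complex.smul_re,
      Complex.smul_re] at h1
    rw [← inner_self_eq_norm_sq (𝕜 := ℂ)]
    exact sub_nonneg.1 h1
  refine le_of_forall_pos_le_add fun ε hε => ?_
  have h1 := key (ε / (‖k‖ ^ 2 + 1)) (by positivity)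
  have h2 : ε / (‖k‖ ^ 2 + 1) * ‖k‖ ^ 2 ≤ ε := by
    rw [div_mul_eq_mul_div, div_le_iff₀ (by positivity)]
    nlinarith [sq_nonneg ‖k‖]
  linarith

end FuncCalc

section Units

variable {H : Type*} [NormedAddCommGroup H] [InnerProductSpace ℂ H] [CompleteSpace H]

theorem isSelfAdjoint_units_inv {u : (H →L[ℂ] H)ˣ} (hu : IsSelfAdjoint (u : H →L[ℂ] H)) :
    IsSelfAdjoint (↑u⁻¹ : H →L[ℂ] H) := by
  have hu' : star u = u := Units.ext (by rw [Units.coe_star]; exact hu)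
  have : star u⁻¹ = u⁻¹ := by rw [star_inv, hu']
  rw [isSelfAdjoint_iff, ← Units.coe_star, this]

end Units

/-! ### Transport of the form domain to H by (A - e)^{-1/2} -/

section FormDomain

variable {H : Type*} [NormedAddCommGroup H] [InnerProductSpace ℂ H] [CompleteSpace H]
  {A : H →ₗ.[ℂ] H}

theorem isResolvent_base (hA : IsSelfAdjoint A) (hs : IsSemibounded A) :
    IsResolvent A (base A : ℂ) (resolvent A (base A : ℂ)) ∧ 0 ≤ resolvent A (base A : ℂ) := by
  obtain ⟨R, hR, hR0⟩ := exists_isResolvent hA (isLowerBound_lowerBound hs)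
    (e := base A) (by rw [base]; linarith)
  rw [hR.resolvent_eq]
  exact ⟨hR, hR0⟩

variable (A) in
/-- The operator `(A - e)^{-1/2}` at the base point. -/
noncomputable def baseSqrt : H →L[ℂ] H := invSqrt A (base A)

theorem isSelfAdjoint_baseSqrt : IsSelfAdjoint (baseSqrt A) :=
  IsSelfAdjoint.of_nonneg (CFC.sqrt_nonneg _)

theorem baseSqrt_mul_self (hA : IsSelfAdjoint A) (hs : IsSemibounded A) :
    baseSqrt A * baseSqrt A = resolvent A (base A : ℂ) :=
  CFC.sqrt_mul_sqrt_self _ (isResolvent_base hA hs).2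

theorem baseSqrt_injective (hA : IsSelfAdjoint A) (hs : IsSemibounded A) :
    Function.Injective (baseSqrt A) := by
  rw [injective_iff_map_eq_zero]
  intro x hx
  refine (isResolvent_base hA hs).1.injective ?_
  rw [← baseSqrt_mul_self hA hs, mul_apply_eq_comp, hx, map_zero]

theorem baseSqrt_mem (x : H) : baseSqrt A x ∈ formDomain A := by
  change _ ∈ (sqrtShift A (base A)).domain
  rw [sqrtShift, LinearPMap.inverse_domain]
  exact ⟨⟨x, Submodule.mem_top⟩, rfl⟩

theorem exists_baseSqrt_eq (u : formDomain A) : ∃ x, baseSqrt A x = u := by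
  have h : (u : H) ∈ (sqrtShift A (base A)).domain := u.2
  rw [sqrtShift, LinearPMap.inverse_domain] at h
  obtain ⟨y, hy⟩ := h
  exact ⟨y, hy⟩

variable (A) in
/-- The map `(A - e)^{-1/2}` from `H` onto the form domain. -/
noncomputable def formLift : H →ₗ[ℂ] formDomain A :=
  (baseSqrt A).toLinearMap.codRestrict _ baseSqrt_mem

@[simp]
theorem coe_formLift (x : H) : (formLift A x : H) = baseSqrt A x := rfl

theorem formLift_surjective : Function.Surjective (formLift A) := fun u => by
  obtain ⟨x, hx⟩ := exists_baseSqrt_eq u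
  exact ⟨x, Subtype.ext hx⟩

theorem sqrtShift_formLift (hA : IsSelfAdjoint A) (hs : IsSemibounded A) (x : H) :
    sqrtShift A (base A) (formLift A x) = x := by
  have hker : LinearMap.ker ((invSqrt A (base A)).toLinearMap.toPMap ⊤).toFun = ⊥ := by
    rw [LinearMap.ker_eq_bot]
    intro x y h
    exact Subtype.ext (baseSqrt_injective hA hs h)
  exact LinearPMap.inverse_apply_eq hker (x := ⟨x, Submodule.mem_top⟩) rfl

theorem formNorm_formLift (hA : IsSelfAdjoint A) (hs : IsSemibounded A) (x : H) :
    formNorm A (formLift A x) = ‖x‖ := by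
  rw [formNorm, sqrtShift_formLift hA hs]

/-- From ⟪S x, S y⟫ = ⟪x, R y⟫: this replaces the unbounded form by a bounded operator. -/
theorem form_formLift (hA : IsSelfAdjoint A) (hs : IsSemibounded A) (E : ℝ) (x y : H) :
    (formOf A).form (formLift A x) (formLift A y) -
        (E : ℂ) * ⟪(formLift A x : H), (formLift A y : H)⟫_ℂ =
      ⟪x, SpectralGap.shifted (resolvent A (base A : ℂ)) (E - base A) y⟫_ℂ := by
  change (⟪sqrtShift A (base A) (formLift A x), sqrtShift A (base A) (formLift A y)⟫_ℂ +
    (base A : ℂ) * ⟪(formLift A x : H), (formLift A y : H)⟫_ℂ) - _ = _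
  rw [sqrtShift_formLift hA hs, sqrtShift_formLift hA hs, SpectralGap.shifted,
    ← baseSqrt_mul_self hA hs, sub_apply, inner_sub_right, smul_apply, ← Complex.coe_smul,
    inner_smul_right, mul_apply_eq_comp, one_apply_eq_self, coe_formLift, coe_formLift]
  have : ⟪x, baseSqrt A (baseSqrt A y)⟫_ℂ = ⟪baseSqrt A x, baseSqrt A y⟫_ℂ := by
    rw [← ContinuousLinearMap.adjoint_inner_left, isSelfAdjoint_baseSqrt.adjoint_eq]
  rw [this]
  push_cast
  ring

theorem isUnit_shifted (hA : IsSelfAdjoint A) (hs : IsSemibounded A) {E : ℝ}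
    (hE : (E : ℂ) ∉ spectrum A) :
    IsUnit (SpectralGap.shifted (resolvent A (base A : ℂ)) (E - base A)) := by
  have := (isResolvent_base hA hs).1.isUnit_one_sub (IsResolvent.of_notMem_spectrum hE)
  rwa [← Complex.ofReal_sub, Complex.coe_smul] at this

end FormDomain

/-! ### Factorizations and Birman–Schwinger operators -/

section Factor

variable {H : Type*} [NormedAddCommGroup H] [InnerProductSpace ℂ H] [CompleteSpace H]
  {A : H →ₗ.[ℂ] H} {K : Type*} [NormedAddCommGroup K] [InnerProductSpace ℂ K]

/-- `formLift` is isometric from H to H₊₁, so it sends unit ball to unit ball. -/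
theorem IsFactorization.isCompactOperator_comp (hA : IsSelfAdjoint A) (hs : IsSemibounded A)
    {B : SesqForm H} {C : formDomain A →ₗ[ℂ] K} (hC : IsFactorization A B C) :
    IsCompactOperator (C ∘ₗ formLift A) := by
  rw [isCompactOperator_iff_image_closedBall_subset_compact _ one_pos]
  refine ⟨_, hC.compact, ?_⟩
  rintro _ ⟨x, hx, rfl⟩
  refine subset_closure ⟨formLift A x, ?_, rfl⟩
  rw [Set.mem_ofPred_eq, formNorm_formLift hA hs]
  exact mem_closedBall_zero_iff.1 hx

theorem IsFactorization.exists_clm (hA : IsSelfAdjoint A) (hs : IsSemibounded A)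
    {B : SesqForm H} {C : formDomain A →ₗ[ℂ] K} (hC : IsFactorization A B C) :
    ∃ D : H →L[ℂ] K, IsCompactOperator D ∧ ∀ x, C (formLift A x) = D x :=
  ⟨ContinuousLinearMap.mkOfIsCompactOperator (hC.isCompactOperator_comp hA hs),
    hC.isCompactOperator_comp hA hs, fun _ => rfl⟩

variable [CompleteSpace K]

theorem mem_sandwichGraph_iff (hA : IsSelfAdjoint A) (hs : IsSemibounded A)
    {C : formDomain A →ₗ[ℂ] K} {D : H →L[ℂ] K} (hD : ∀ x, C (formLift A x) = D x) (E : ℝ)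
    (p : K × K) : p ∈ sandwichGraph A C E ↔ ∃ y, D y = p.2 ∧
      SpectralGap.shifted (resolvent A (base A : ℂ)) (E - base A) y = D.adjoint p.1 := by
  change (∃ u : formDomain A, C u = p.2 ∧
    ∀ v : formDomain A, (formOf A).form v u - (E : ℂ) * ⟪(v : H), (u : H)⟫_ℂ = ⟪C v, p.1⟫_ℂ) ↔ _
  rw [formLift_surjective.exists]
  refine exists_congr fun y => and_congr (by rw [hD]) ?_
  rw [formLift_surjective.forall]
  simp only [form_formLift hA hs, hD]
  constructor
  · intro h
    refine ext_inner_left ℂ fun x => ?_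
    rw [h, ContinuousLinearMap.adjoint_inner_right]
  · intro h x
    rw [h, ContinuousLinearMap.adjoint_inner_right]

/-- The Birman--Schwinger operator is a bounded self-adjoint operator. -/
theorem exists_sandwich_eq (hA : IsSelfAdjoint A) (hs : IsSemibounded A)
    {C : formDomain A →ₗ[ℂ] K} {D : H →L[ℂ] K} (hD : ∀ x, C (formLift A x) = D x) {E : ℝ}
    (hE : (E : ℂ) ∉ spectrum A) : ∃ x : K →L[ℂ] K, IsSelfAdjoint x ∧
      (∀ p, p ∈ (sandwich A C E).graph ↔ x p.1 = p.2) ∧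
      ∀ k y, SpectralGap.shifted (resolvent A (base A : ℂ)) (E - base A) y = D.adjoint k →
        D y = x k := by
  obtain ⟨u, hu⟩ := isUnit_shifted hA hs hE
  have hsh : IsSelfAdjoint (SpectralGap.shifted (resolvent A (base A : ℂ)) (E - base A)) :=
    SpectralGap.isSelfAdjoint_shifted (.of_nonneg (isResolvent_base hA hs).2) _
  have hsol : ∀ k y, SpectralGap.shifted (resolvent A (base A : ℂ)) (E - base A) y = D.adjoint k ↔
      y = (↑u⁻¹ : H →L[ℂ] H) (D.adjoint k) := by
    intro k y
    rw [← hu]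
    constructor
    · intro h
      rw [← h, ← mul_apply_eq_comp, Units.inv_mul]; rfl
    · rintro rfl
      rw [← mul_apply_eq_comp, Units.mul_inv]; rfl
  -- The operator D F(E)⁻¹ D*.
  let x : K →L[ℂ] K := D ∘L (↑u⁻¹ : H →L[ℂ] H) ∘L D.adjoint
  have hmem : ∀ p, p ∈ sandwichGraph A C E ↔ x p.1 = p.2 := fun p => by
    rw [mem_sandwichGraph_iff hA hs hD]
    constructor
    · rintro ⟨y, hy, hy'⟩
      rw [hsol] at hy'
      rw [← hy, hy']; rfl
    · intro h
      exact ⟨_, h, (hsol _ _).2 rfl⟩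
  have hui : IsSelfAdjoint (↑u⁻¹ : H →L[ℂ] H) := isSelfAdjoint_units_inv (hu ▸ hsh)
  refine ⟨x, hui.conj_adjoint D, fun p => ?_, fun k y h => ?_⟩
  · rw [sandwich, Submodule.toLinearPMap_graph_eq _ fun p hp h0 => ?_, hmem]
    rw [← (hmem p).1 hp, h0, map_zero]
  · rw [(hsol k y).1 h]; rfl

end Factor

/-! ### The operator of the form sum and its resolvent -/

section FormSum

variable {H : Type*} [NormedAddCommGroup H] [InnerProductSpace ℂ H] [CompleteSpace H]
  {A : H →ₗ.[ℂ] H} {K₁ : Type*} [NormedAddCommGroup K₁] [InnerProductSpace ℂ K₁] [CompleteSpace K₁]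
  {K₂ : Type*} [NormedAddCommGroup K₂] [InnerProductSpace ℂ K₂] [CompleteSpace K₂]
  {Bp Bm : SesqForm H} {Cp : formDomain A →ₗ[ℂ] K₁} {Cm : formDomain A →ₗ[ℂ] K₂}
  {D₁ : H →L[ℂ] K₁} {D₂ : H →L[ℂ] K₂}

/-- The weak equation defining the operator, with u = S y and test vectors S x. The graph does not
depend on E, so any convenient E may be chosen. -/
theorem mem_graph_operator_iff (hA : IsSelfAdjoint A) (hs : IsSemibounded A)
    (hCp : IsFactorization A Bp Cp) (hCm : IsFactorization A Bm Cm)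
    (hD₁ : ∀ x, Cp (formLift A x) = D₁ x) (hD₂ : ∀ x, Cm (formLift A x) = D₂ x) (E : ℝ)
    (p : H × H) : p ∈ (formOf A + Bp - Bm).operator.graph ↔
      ∃ y, baseSqrt A y = p.1 ∧
        SpectralGap.perturbed (resolvent A (base A : ℂ)) D₁ D₂ (E - base A) y =
          baseSqrt A (p.2 - (E : ℂ) • p.1) := by
  have hle : formDomain A ≤ (formOf A + Bp - Bm).domain :=
    le_inf (le_inf le_rfl hCp.domain_le) hCm.domain_le
  have hform : ∀ x y : H, (formOf A + Bp - Bm).form (Submodule.inclusion hle (formLift A x))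
      (Submodule.inclusion hle (formLift A y)) - (E : ℂ) * ⟪baseSqrt A x, baseSqrt A y⟫_ℂ =
      ⟪x, SpectralGap.perturbed (resolvent A (base A : ℂ)) D₁ D₂ (E - base A) y⟫_ℂ := by
    intro x y
    have h1 : (formOf A + Bp - Bm).form (Submodule.inclusion hle (formLift A x))
      (Submodule.inclusion hle (formLift A y)) =
      (formOf A).form (formLift A x) (formLift A y) +
      Bp.form (Submodule.inclusion hCp.domain_le (formLift A x))
        (Submodule.inclusion hCp.domain_le (formLift A y)) -
      Bm.form (Submodule.inclusion hCm.domain_le (formLift A x))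
        (Submodule.inclusion hCm.domain_le (formLift A y)) := rfl
    have h2 := form_formLift hA hs E x y
    rw [coe_formLift, coe_formLift] at h2
    rw [h1, hCp.form_eq, hCm.form_eq, hD₁, hD₁, hD₂, hD₂, SpectralGap.perturbed, sub_apply,
      add_apply, inner_sub_right, inner_add_right, ← h2, ContinuousLinearMap.comp_apply,
      ContinuousLinearMap.comp_apply, ContinuousLinearMap.adjoint_inner_right,
      ContinuousLinearMap.adjoint_inner_right]
    ring
  have hsurj : ∀ u : (formOf A + Bp - Bm).domain, ∃ x, u = Submodule.inclusion hle (formLift A x) :=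
    fun u => by
      obtain ⟨x, hx⟩ := exists_baseSqrt_eq (⟨u, u.2.1.1⟩ : formDomain A)
      exact ⟨x, Subtype.ext hx.symm⟩
  have hmem : ∀ p, p ∈ (formOf A + Bp - Bm).operatorGraph ↔
      ∃ y, baseSqrt A y = p.1 ∧
        SpectralGap.perturbed (resolvent A (base A : ℂ)) D₁ D₂ (E - base A) y =
          baseSqrt A (p.2 - (E : ℂ) • p.1) := by
    intro p
    have hadj : ∀ x w : H, ⟪x, baseSqrt A w⟫_ℂ = ⟪baseSqrt A x, w⟫_ℂ := fun x w => by
      rw [← ContinuousLinearMap.adjoint_inner_left, isSelfAdjoint_baseSqrt.adjoint_eq]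
    constructor
    · rintro ⟨u, hu, hu'⟩
      obtain ⟨y, rfl⟩ := hsurj u
      have hy : baseSqrt A y = p.1 := hu
      refine ⟨y, hy, ext_inner_left ℂ fun x => ?_⟩
      rw [← hform, hu', hadj x (p.2 - (E : ℂ) • p.1), inner_sub_right, ← hy, inner_smul_right]
      rfl
    · rintro ⟨y, hy, hy'⟩
      refine ⟨Submodule.inclusion hle (formLift A y), hy, fun v => ?_⟩
      obtain ⟨x, rfl⟩ := hsurj v
      have h1 := hform x y
      rw [hy', hadj x (p.2 - (E : ℂ) • p.1), inner_sub_right, ← hy, inner_smul_right] at h1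
      exact sub_left_injective h1
  -- `toLinearPMap` has the intended graph only if the relation is single-valued; injectivity of S
  -- gives this.
  rw [SesqForm.operator, Submodule.toLinearPMap_graph_eq _ fun p hp h0 => ?_, hmem]
  obtain ⟨y, hy, hy'⟩ := (hmem p).1 hp
  rw [h0] at hy
  have hy0 : y = 0 := baseSqrt_injective hA hs (by rw [hy, map_zero])
  rw [hy0, map_zero, h0, smul_zero, sub_zero] at hy'
  exact baseSqrt_injective hA hs (by rw [← hy', map_zero])

/-- A kernel vector x would give an eigenvector S x with eigenvalue E. -/
theorem perturbed_injective (hA : IsSelfAdjoint A) (hs : IsSemibounded A)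
    (hCp : IsFactorization A Bp Cp) (hCm : IsFactorization A Bm Cm)
    (hD₁ : ∀ x, Cp (formLift A x) = D₁ x) (hD₂ : ∀ x, Cm (formLift A x) = D₂ x) {E : ℝ}
    (hE : (E : ℂ) ∉ spectrum (formOf A + Bp - Bm).operator) {x : H}
    (hx : SpectralGap.perturbed (resolvent A (base A : ℂ)) D₁ D₂ (E - base A) x = 0) : x = 0 := by
  have h := (isResolvent_iff_graph.1 (IsResolvent.of_notMem_spectrum hE)).2
    (baseSqrt A x, (E : ℂ) • baseSqrt A x)
    ((mem_graph_operator_iff hA hs hCp hCm hD₁ hD₂ E _).2 ⟨x, rfl, by simp [hx]⟩)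
  simp only [sub_self, map_zero] at h
  exact baseSqrt_injective hA hs (by rw [← h, map_zero])

theorem isResolvent_operator (hA : IsSelfAdjoint A) (hs : IsSemibounded A)
    (hCp : IsFactorization A Bp Cp) (hCm : IsFactorization A Bm Cm)
    (hD₁ : ∀ x, Cp (formLift A x) = D₁ x) (hD₂ : ∀ x, Cm (formLift A x) = D₂ x) {E : ℝ}
    {u : (H →L[ℂ] H)ˣ}
    (hu : SpectralGap.perturbed (resolvent A (base A : ℂ)) D₁ D₂ (E - base A) = u) :
    IsResolvent (formOf A + Bp - Bm).operator E (baseSqrt A * ↑u⁻¹ * baseSqrt A) := by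
  have hmem := mem_graph_operator_iff hA hs hCp hCm hD₁ hD₂ E
  rw [hu] at hmem
  refine isResolvent_iff_graph.2 ⟨fun x => (hmem _).2 ⟨(↑u⁻¹ : H →L[ℂ] H) (baseSqrt A x), rfl, ?_⟩,
    fun p hp => ?_⟩
  · rw [← mul_apply_eq_comp, Units.mul_inv, add_sub_cancel_right]; rfl
  · obtain ⟨y, hy, hy'⟩ := (hmem p).1 hp
    have h : (↑u⁻¹ : H →L[ℂ] H) ((u : H →L[ℂ] H) y) = y := by
      rw [← mul_apply_eq_comp, Units.inv_mul]; rfl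
    rw [mul_apply_eq_comp, ← hy', mul_apply_eq_comp, h, hy]

end FormSum

/-! ### The counting function through the resolvent -/

section Counting

variable {H : Type*} [NormedAddCommGroup H] [InnerProductSpace ℂ H] [CompleteSpace H]

theorem N_eq_toENat_rank (T : H →ₗ.[ℂ] H) (U : Set ℝ) :
    N T U = Cardinal.toENat (Module.rank ℂ (spectralSubspace T U)) := by
  have : CompleteSpace (spectralSubspace T U) :=
    (Submodule.isClosed_topologicalClosure _).completeSpace_coe
  have h : LinearMap.range (spectralProjection T U).toLinearMap = spectralSubspace T U :=
    Submodule.range_starProjection _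
  rw [N, h]

theorem N_le_of_spectralSubspace_le {T : H →ₗ.[ℂ] H} {U : Set ℝ} {W : Submodule ℂ H}
    [FiniteDimensional ℂ W] (h : spectralSubspace T U ≤ W) : N T U ≤ Module.finrank ℂ W := by
  rw [N_eq_toENat_rank, ← Cardinal.toENat_nat, Module.finrank_eq_rank]
  exact Cardinal.toENat.monotone' (Submodule.rank_mono h)

theorem finiteDimensional_of_N_ne_top {T : H →ₗ.[ℂ] H} {U : Set ℝ} (h : N T U ≠ ⊤) :
    FiniteDimensional ℂ (spectralSubspace T U) := by
  rw [N_eq_toENat_rank, Ne, Cardinal.toENat_eq_top, not_le] at h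
  exact Module.rank_lt_aleph0_iff.1 h

theorem N_eq_finrank {T : H →ₗ.[ℂ] H} {U : Set ℝ} [FiniteDimensional ℂ (spectralSubspace T U)] :
    N T U = Module.finrank ℂ (spectralSubspace T U) := by
  rw [N_eq_toENat_rank, ← Module.finrank_eq_rank, Cardinal.toENat_nat]

theorem N_empty (T : H →ₗ.[ℂ] H) : N T ∅ = 0 := by
  have : spectralSubspace T ∅ ≤ ⊥ := by
    refine Submodule.topologicalClosure_minimal _ (iSup₂_le fun f hf => ?_) isClosed_singleton
    have h0 : f = 0 := by
      ext t
      by_contra h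
      exact hf.2.2 (subset_tsupport f h)
    rintro _ ⟨x, rfl⟩
    simp [h0, funcCalc, cfc_const_zero]
  simpa using N_le_of_spectralSubspace_le this

/-- If `T` has the real point `α` in its resolvent set, the range of `f(T)`, for `f` supported in
`(α, β)`, is contained in a spectral subspace of `(T - α)⁻¹` strictly above `(β - α)⁻¹`. -/
theorem exists_range_funcCalc_le {T : H →ₗ.[ℂ] H} {α β : ℝ} (hαβ : α < β) {x : H →L[ℂ] H}
    (hx : IsSelfAdjoint x) (hT : IsResolvent T α x) {f : ℝ → ℝ} (hf : Continuous f)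
    (hfc : HasCompactSupport f) (hfU : tsupport f ⊆ Set.Ioo α β) :
    ∃ c, (β - α)⁻¹ < c ∧
      LinearMap.range (funcCalc T f).toLinearMap ≤ SpectralGap.upperSubspace x c := by
  obtain ⟨γ, hαγ, hγβ, hγ⟩ : ∃ γ, α < γ ∧ γ < β ∧ ∀ t ∈ tsupport f, t ≤ γ := by
    rcases (tsupport f).eq_empty_or_nonempty with h | h
    · obtain ⟨γ, h1, h2⟩ := exists_between hαβ
      exact ⟨γ, h1, h2, by simp [h]⟩
    · obtain ⟨γ, h1, h2⟩ := hfc.isCompact.exists_isGreatest h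
      exact ⟨γ, (hfU h1).1, (hfU h1).2, h2⟩
  have hd : 0 < β - α := sub_pos.2 hαβ
  have hd' : 0 < (β - α)⁻¹ := inv_pos.2 hd
  have hg : 0 < γ - α := sub_pos.2 hαγ
  have hfz : ∀ t, γ < t → f t = 0 := fun t ht =>
    image_eq_zero_of_notMem_tsupport fun h => (hγ t h).not_gt ht
  have hfz' : ∀ t, t ≤ α → f t = 0 := fun t ht =>
    image_eq_zero_of_notMem_tsupport fun h => (hfU h).1.not_ge ht
  -- This is f(t⁻¹ + α), with the cut-off at (β - α)⁻¹ making it continuous at 0. As f vanishes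
  -- above γ < β, h vanishes below (γ - α)⁻¹.
  let h : ℝ → ℝ := fun t => f ((max t (β - α)⁻¹)⁻¹ + α)
  have hpos : ∀ t : ℝ, 0 < max t (β - α)⁻¹ := fun t => hd'.trans_le (le_max_right _ _)
  have hcont : Continuous h :=
    hf.comp ((Continuous.inv₀ (by fun_prop) fun t => (hpos t).ne').add continuous_const)
  have hlow : ∀ t < (γ - α)⁻¹, h t = 0 := by
    intro t ht
    refine hfz _ ?_
    have h1 : max t (β - α)⁻¹ < (γ - α)⁻¹ := max_lt ht (inv_strictAnti₀ hg (by linarith))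
    have h2 := inv_strictAnti₀ (hpos t) h1
    rw [inv_inv] at h2
    linarith
  refine ⟨(γ - α)⁻¹, inv_strictAnti₀ hg (by linarith), ?_⟩
  rw [funcCalc_eq_cfc_resolvent hx hT hcont (hlow 0 (inv_pos.2 hg)) fun t ht => ?_]
  · exact SpectralGap.range_cfc_le_upperSubspace hcont hlow
  · rcases lt_or_ge t (γ - α)⁻¹ with h1 | h1
    · rw [hlow t h1]
      rcases lt_or_gt_of_ne ht with h2 | h2
      · rw [hfz']
        have := inv_lt_zero.2 h2
        linarith
      · rw [hfz]
        have := inv_strictAnti₀ h2 h1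
        rw [inv_inv] at this
        linarith
    · have h2 : (β - α)⁻¹ ≤ t := (inv_strictAnti₀ hg (by linarith)).le.trans h1
      simp only [h, max_eq_left h2]

/-- A uniform bound on the dimensions of the spectral subspaces of `(T - α)⁻¹` strictly above
`(β - α)⁻¹` bounds the number of eigenvalues of `T` in `(α, β)`. -/
theorem N_Ioo_le {T : H →ₗ.[ℂ] H} {α β : ℝ} (hαβ : α < β) {x : H →L[ℂ] H}
    (hx : IsSelfAdjoint x) (hT : IsResolvent T α x) {n : ℕ}
    (hfin : ∀ c, (β - α)⁻¹ < c → FiniteDimensional ℂ (SpectralGap.upperSubspace x c))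
    (hn : ∀ c, (β - α)⁻¹ < c → Module.finrank ℂ (SpectralGap.upperSubspace x c) ≤ n) :
    N T (Set.Ioo α β) ≤ n := by
  -- The subspaces grow as c decreases and their dimensions are bounded, so one of maximal dimension
  -- contains all the others.
  let s : Set ℕ := {k | ∃ c, (β - α)⁻¹ < c ∧ Module.finrank ℂ (SpectralGap.upperSubspace x c) = k}
  have hs : s.Nonempty := ⟨_, (β - α)⁻¹ + 1, by linarith, rfl⟩
  have hb : BddAbove s := ⟨n, by rintro _ ⟨c, hc, rfl⟩; exact hn c hc⟩
  obtain ⟨c₀, hc₀, hc₀'⟩ := Nat.sSup_mem hs hb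
  have := hfin c₀ hc₀
  have hle : ∀ c, (β - α)⁻¹ < c →
      SpectralGap.upperSubspace x c ≤ SpectralGap.upperSubspace x c₀ := by
    intro c hc
    have hm : (β - α)⁻¹ < min c c₀ := lt_min hc hc₀
    have := hfin _ hm
    have h1 := Submodule.eq_of_le_of_finrank_le
      (SpectralGap.upperSubspace_anti (x := x) (min_le_right c c₀)) (by
        rw [hc₀']; exact le_csSup hb ⟨_, hm, rfl⟩)
    rw [h1]
    exact SpectralGap.upperSubspace_anti (min_le_left c c₀)
  refine (N_le_of_spectralSubspace_le (W := SpectralGap.upperSubspace x c₀) ?_).trans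
    (Nat.cast_le.2 (hn c₀ hc₀))
  refine Submodule.topologicalClosure_minimal _ (iSup₂_le fun f hf => ?_)
    (Submodule.closed_of_finiteDimensional _)
  obtain ⟨c, hc, hfc⟩ := exists_range_funcCalc_le hαβ hx hT hf.1 hf.2.1 hf.2.2
  exact hfc.trans (hle c hc)

end Counting

/-! ### Assembling the bound -/

section Bound

variable {H : Type*} [NormedAddCommGroup H] [InnerProductSpace ℂ H] [CompleteSpace H]
  {K₁ : Type*} [NormedAddCommGroup K₁] [InnerProductSpace ℂ K₁] [CompleteSpace K₁]
  {K₂ : Type*} [NormedAddCommGroup K₂] [InnerProductSpace ℂ K₂] [CompleteSpace K₂]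

open SpectralGap

/-- The resolvent of `A` at a point `E ∉ σ(A)`, sandwiched between square roots. -/
theorem isResolvent_baseSqrt_mul {A : H →ₗ.[ℂ] H} (hA : IsSelfAdjoint A) (hs : IsSemibounded A)
    {E : ℝ} {u : (H →L[ℂ] H)ˣ}
    (hu : (u : H →L[ℂ] H) = shifted (resolvent A (base A : ℂ)) (E - base A)) :
    IsResolvent A E (baseSqrt A * ↑u⁻¹ * baseSqrt A) := by
  have hR := baseSqrt_mul_self hA hs
  have hc : Commute (baseSqrt A) (u : H →L[ℂ] H) := by
    rw [hu, shifted, ← hR]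
    exact (Commute.one_right _).sub_right
      (((Commute.refl _).mul_right (Commute.refl _)).smul_right _)
  have hc' : Commute (baseSqrt A) (↑u⁻¹ : H →L[ℂ] H) := hc.units_inv_right
  have he : baseSqrt A * ↑u⁻¹ * baseSqrt A = resolvent A (base A : ℂ) * ↑u⁻¹ := by
    rw [mul_assoc, ← hc'.eq, ← mul_assoc, hR]
  have hu' : 1 - ((E : ℂ) - (base A : ℂ)) • resolvent A (base A : ℂ) = u := by
    rw [hu, shifted, ← Complex.ofReal_sub, Complex.coe_smul]
  rw [he]
  refine (isResolvent_base hA hs).1.mul_inv ?_ ?_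
  · rw [hu', Units.mul_inv]
  · rw [hu', Units.inv_mul]

/-- The resolvent of `A + B₊ - B₋` at a point below a gap of `A`: its spectral subspaces
corresponding to compact subsets of the gap are finite-dimensional. -/
theorem exists_resolvent_operator {A : H →ₗ.[ℂ] H} (hA : IsSelfAdjoint A)
    (hs : IsSemibounded A) {Bp Bm : SesqForm H}
    {Cp : formDomain A →ₗ[ℂ] K₁} (hCp : IsFactorization A Bp Cp)
    {Cm : formDomain A →ₗ[ℂ] K₂} (hCm : IsFactorization A Bm Cm)
    {D₁ : H →L[ℂ] K₁} {D₂ : H →L[ℂ] K₂} (hD₁ : ∀ x, Cp (formLift A x) = D₁ x)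
    (hD₂ : ∀ x, Cm (formLift A x) = D₂ x) (hD₁c : IsCompactOperator D₁)
    (hD₂c : IsCompactOperator D₂) {α β : ℝ} (hαβ : α < β)
    (hgap : ∀ E ∈ Set.Icc α β, (E : ℂ) ∉ spectrum A)
    (hα : (α : ℂ) ∉ spectrum (formOf A + Bp - Bm).operator) :
    IsUnit (perturbed (resolvent A (base A : ℂ)) D₁ D₂ (α - base A)) ∧
      ∃ x : H →L[ℂ] H, IsSelfAdjoint x ∧ IsResolvent (formOf A + Bp - Bm).operator α x ∧
        (∀ c, (β - α)⁻¹ < c → FiniteDimensional ℂ (upperSubspace x c)) ∧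
        (∀ z, ∃ v, baseSqrt A v = x z) ∧
        ∀ v z, baseSqrt A v = x z →
          perturbed (resolvent A (base A : ℂ)) D₁ D₂ (α - base A) v = baseSqrt A z := by
  have hRs : IsSelfAdjoint (resolvent A (base A : ℂ)) := .of_nonneg (isResolvent_base hA hs).2
  have hS : IsSelfAdjoint (baseSqrt A) := isSelfAdjoint_baseSqrt
  have hFa := isUnit_shifted hA hs (hgap α ⟨le_rfl, hαβ.le⟩)
  have hcomp := isCompactOperator_perturbed_sub_shifted (R := resolvent A (base A : ℂ))
    hD₁c hD₂c (α - base A)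
  -- A compact perturbation of the invertible F(α), injective because α is not in the spectrum of
  -- the form sum.
  have hG : IsUnit (perturbed (resolvent A (base A : ℂ)) D₁ D₂ (α - base A)) :=
    IsCompactOperator.isUnit_of_sub hFa hcomp fun x hx =>
      perturbed_injective hA hs hCp hCm hD₁ hD₂ hα hx
  refine ⟨hG, ?_⟩
  obtain ⟨u, hu⟩ := hG
  obtain ⟨w, hw⟩ := hFa
  have hus : IsSelfAdjoint (↑u⁻¹ : H →L[ℂ] H) :=
    isSelfAdjoint_units_inv (hu ▸ isSelfAdjoint_perturbed hRs _)
  have hws : IsSelfAdjoint (↑w⁻¹ : H →L[ℂ] H) :=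
    isSelfAdjoint_units_inv (hw ▸ isSelfAdjoint_shifted hRs _)
  have hresA := isResolvent_baseSqrt_mul hA hs hw
  have hx : IsSelfAdjoint (baseSqrt A * ↑u⁻¹ * baseSqrt A) := hus.conjugate_self hS
  have hy : IsSelfAdjoint (baseSqrt A * ↑w⁻¹ * baseSqrt A) := hws.conjugate_self hS
  have hxy : IsCompactOperator
      (baseSqrt A * ↑u⁻¹ * baseSqrt A - baseSqrt A * ↑w⁻¹ * baseSqrt A : H →L[ℂ] H) := by
    have : baseSqrt A * ↑u⁻¹ * baseSqrt A - baseSqrt A * ↑w⁻¹ * baseSqrt A =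
        baseSqrt A ∘L (((↑u⁻¹ : H →L[ℂ] H) - (↑w⁻¹ : H →L[ℂ] H)) ∘L baseSqrt A) := by
      simp only [← ContinuousLinearMap.mul_def, sub_mul, mul_sub, mul_assoc]
    rw [this]
    exact ((IsCompactOperator.inv_sub_inv (by rw [hu, hw]; exact hcomp)).comp_clm' _).clm_comp' _
  refine ⟨baseSqrt A * (↑u⁻¹ : H →L[ℂ] H) * baseSqrt A, hx,
    isResolvent_operator hA hs hCp hCm hD₁ hD₂ hu.symm, fun c hc => ?_, fun z => ⟨_, rfl⟩,
    fun v z h => ?_⟩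
  · exact finiteDimensional_upperSubspace hx hy hxy hc fun t ht =>
      spectrum_resolvent_le hαβ hgap hresA ht
  · have hv : v = (↑u⁻¹ : H →L[ℂ] H) (baseSqrt A z) := baseSqrt_injective hA hs h
    rw [hv, ← hu, ← mul_apply_eq_comp, Units.mul_inv]
    rfl

/-- The core estimate is applied to V = S⁻¹ W for each upper spectral subspace W of the resolvent ρ
at α. With κ inverse to ρ on W, G(α) v = S κ S v on V. -/
theorem N_Ioo_le_finrank_add_finrank {A : H →ₗ.[ℂ] H} (hA : IsSelfAdjoint A)
    (hs : IsSemibounded A) {Bp Bm : SesqForm H}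
    {Cp : formDomain A →ₗ[ℂ] K₁} (hCp : IsFactorization A Bp Cp)
    {Cm : formDomain A →ₗ[ℂ] K₂} (hCm : IsFactorization A Bm Cm) {α β : ℝ} (hαβ : α < β)
    (hgap : ∀ E ∈ Set.Icc α β, (E : ℂ) ∉ spectrum A)
    (hα : (α : ℂ) ∉ spectrum (formOf A + Bp - Bm).operator)
    [FiniteDimensional ℂ (spectralSubspace (sandwich A Cp α) (Set.Iio (-1)))]
    [FiniteDimensional ℂ (spectralSubspace (sandwich A Cm β) (Set.Ioi 1))] :
    N (formOf A + Bp - Bm).operator (Set.Ioo α β) ≤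
      ((Module.finrank ℂ (spectralSubspace (sandwich A Cp α) (Set.Iio (-1))) +
        Module.finrank ℂ (spectralSubspace (sandwich A Cm β) (Set.Ioi 1)) : ℕ) : ℕ∞) := by
  obtain ⟨D₁, hD₁c, hD₁⟩ := hCp.exists_clm hA hs
  obtain ⟨D₂, hD₂c, hD₂⟩ := hCm.exists_clm hA hs
  obtain ⟨hG, ρ, hx, hres, hfin, hran, hsol⟩ :=
    exists_resolvent_operator hA hs hCp hCm hD₁ hD₂ hD₁c hD₂c hαβ hgap hα
  have hR := baseSqrt_mul_self hA hs
  have hR0 := (isResolvent_base hA hs).2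
  have hinj := baseSqrt_injective hA hs
  have hS : IsSelfAdjoint (baseSqrt A) := isSelfAdjoint_baseSqrt
  obtain ⟨x₁, hxs₁, hxg₁, hxD₁⟩ := exists_sandwich_eq hA hs hD₁ (hgap α ⟨le_rfl, hαβ.le⟩)
  obtain ⟨x₂, hxs₂, hxg₂, hxD₂⟩ := exists_sandwich_eq hA hs hD₂ (hgap β ⟨hαβ.le, le_rfl⟩)
  have hF : ∀ E ∈ Set.Icc (α - base A) (β - base A),
      IsUnit (shifted (resolvent A (base A : ℂ)) E) := fun E hE => by
    have := isUnit_shifted hA hs (hgap (E + base A) ⟨by linarith [hE.1], by linarith [hE.2]⟩)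
    rwa [add_sub_cancel_right] at this
  generalize resolvent A (base A : ℂ) = R at *
  generalize baseSqrt A = S at *
  have hadj : ∀ x y : H, ⟪x, S y⟫_ℂ = ⟪S x, y⟫_ℂ := fun x y => by
    rw [← ContinuousLinearMap.adjoint_inner_left, hS.adjoint_eq]
  have hab : α - base A ≤ β - base A := by linarith
  have hd : 0 < β - α := sub_pos.2 hαβ
  refine N_Ioo_le hαβ hx hres hfin fun c hc => ?_
  have hc0 : 0 < c := (inv_pos.2 hd).trans hc
  have := hfin c hc
  set W := upperSubspace ρ c
  set κ := cfc (fun t : ℝ => (max t c)⁻¹) ρ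
  have hfix : ∀ x ∈ W, ρ (κ x) = x := fun x hx' => one_div_max_mul_fix hx hc0 hx'
  have hWS : ∀ x ∈ W, ∃ v, S v = x := fun x hx' => by
    rw [← hfix x hx']; exact hran _
  obtain ⟨q, hqW, hq⟩ := exists_projection_comap hS hinj W hWS
  have hVfin := finiteDimensional_comap hinj W
  have hGv : ∀ v, S v ∈ W → perturbed R D₁ D₂ (α - base A) v = S (κ (S v)) := fun v hv =>
    hsol v _ (hfix _ hv).symm
  have hform : ∀ v, S v ∈ W →
      ⟪v, perturbed R D₁ D₂ (α - base A) v⟫_ℂ = ⟪S v, κ (S v)⟫_ℂ := fun v hv => by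
    rw [hGv v hv, hadj]
  have hrank : Module.finrank ℂ W ≤ Module.finrank ℂ (W.comap S.toLinearMap) := by
    refine le_trans (Submodule.finrank_mono ?_) (Submodule.finrank_map_le S.toLinearMap _)
    intro x hx'
    obtain ⟨v, hv⟩ := hWS x hx'
    exact ⟨v, by simpa [hv] using hx', hv⟩
  refine hrank.trans (finrank_le_add_finrank hR0 hab hF hD₁c hD₂c hG (W.comap S.toLinearMap) q hqW
    (fun v hv x => by rw [← hR]; exact hq v hv x) (fun v hv => ?_) (fun v hv hv0 => ?_)
    (fun v hv hv0 => ?_) _ (fun k hk y hy' => ?_) _ fun k hk y hy' => ?_)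
  · obtain ⟨v', hv'⟩ := hWS _ (apply_mem_upperSubspace (fun t : ℝ => (max t c)⁻¹) hv)
    refine ⟨v', ?_, ?_⟩
    · change S v' ∈ W
      rw [hv']
      exact apply_mem_upperSubspace _ hv
    · rw [hGv v hv, ← hR, mul_apply_eq_comp, hv']
      rfl
  · rw [hform v hv]
    exact inner_one_div_max_pos hx hc0 fun h => hv0 (hinj (by rw [h, map_zero]))
  · have hSv : S v ≠ 0 := fun h => hv0 (hinj (by rw [h, map_zero]))
    have h1 := inner_one_div_max_le hx hc0 (S v)
    have h2 : (⟪v, R v⟫_ℂ).re = ‖S v‖ ^ 2 := by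
      rw [← hR, mul_apply_eq_comp, hadj, ← inner_self_eq_norm_sq (𝕜 := ℂ)]; rfl
    -- G(β) = G(α) - (β - α) R, so the form at v is at most (c⁻¹ - (β - α)) ‖S v‖², negative since c
    -- > (β - α)⁻¹.
    rw [perturbed_apply_eq (α - base A), inner_sub_right, hform v hv, ← Complex.coe_smul,
      inner_smul_right, Complex.sub_re, Complex.re_ofReal_mul, h2]
    have h3 : c⁻¹ < β - α := by
      have := inv_strictAnti₀ (inv_pos.2 hd) hc
      rwa [inv_inv] at this
    have h4 := mul_lt_mul_of_pos_right h3 (pow_pos (norm_pos_iff.2 hSv) 2)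
    have h5 : β - base A - (α - base A) = β - α := by ring
    rw [h5]
    linarith
  · rw [hxD₁ k y hy']
    have := mul_re_inner_le_of_mem_orthogonal hxs₁ hxg₁ (s := -1) (c := 1) (by simp)
      (U := Set.Iio (-1)) (fun t ht => by rw [Set.mem_Iio]; linarith) hk
    linarith
  · rw [hxD₂ k y hy']
    have := mul_re_inner_le_of_mem_orthogonal hxs₂ hxg₂ (s := 1) (c := 1) (by simp)
      (U := Set.Ioi 1) (fun t ht => by rw [Set.mem_Ioi]; linarith) hk
    linarith

end Bound

end GapBound

/-- The decoupled Birman--Schwinger bound in a gap. `A + B₊`, `A - B₋` and `A + B₊ - B₋` are the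
operators associated with the form sums on `Q(A)`. -/
theorem theorem1p4
    {H : Type*} [NormedAddCommGroup H] [InnerProductSpace ℂ H] [CompleteSpace H]
    {K₁ : Type*} [NormedAddCommGroup K₁] [InnerProductSpace ℂ K₁] [CompleteSpace K₁]
    {K₂ : Type*} [NormedAddCommGroup K₂] [InnerProductSpace ℂ K₂] [CompleteSpace K₂]
    (A : H →ₗ.[ℂ] H) (hA : IsSelfAdjoint A) (hA_semi : GapBound.IsSemibounded A)
    (Bp Bm : GapBound.SesqForm H)
    (hBp : Bp.Nonneg) (hBm : Bm.Nonneg)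
    (hBp_comp : GapBound.IsRelFormCompact A Bp) (hBm_comp : GapBound.IsRelFormCompact A Bm)
    (Cp : GapBound.formDomain A →ₗ[ℂ] K₁) (hCp : GapBound.IsFactorization A Bp Cp)
    (Cm : GapBound.formDomain A →ₗ[ℂ] K₂) (hCm : GapBound.IsFactorization A Bm Cm)
    (α β : ℝ) (hαβ : α ≤ β)
    (hgap : ∀ E ∈ Set.Icc α β, (E : ℂ) ∉ GapBound.spectrum A)
    (hends : ∀ E ∈ ({α, β} : Set ℝ),
      (E : ℂ) ∉ GapBound.spectrum (GapBound.formOf A + Bp).operator ∧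
      (E : ℂ) ∉ GapBound.spectrum (GapBound.formOf A - Bm).operator ∧
      (E : ℂ) ∉ GapBound.spectrum (GapBound.formOf A + Bp - Bm).operator) :
    GapBound.N (GapBound.formOf A + Bp - Bm).operator (Set.Ioo α β) ≤
      GapBound.N (GapBound.sandwich A Cp α) (Set.Iio (-1)) +
        GapBound.N (GapBound.sandwich A Cm β) (Set.Ioi 1) := by
  rcases hαβ.eq_or_lt with rfl | hlt
  · rw [Set.Ioo_self, GapBound.N_empty]
    exact zero_le
  -- An infinite right-hand side is trivial; otherwise both spectral subspaces are
  -- finite-dimensional and serve as M₁ and M₂.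
  by_cases h₁ : GapBound.N (GapBound.sandwich A Cp α) (Set.Iio (-1)) = ⊤
  · rw [h₁, top_add]; exact le_top
  by_cases h₂ : GapBound.N (GapBound.sandwich A Cm β) (Set.Ioi 1) = ⊤
  · rw [h₂, add_top]; exact le_top
  have := GapBound.finiteDimensional_of_N_ne_top h₁
  have := GapBound.finiteDimensional_of_N_ne_top h₂
  rw [GapBound.N_eq_finrank (T := GapBound.sandwich A Cp α),
    GapBound.N_eq_finrank (T := GapBound.sandwich A Cm β), ← Nat.cast_add]
  exact GapBound.N_Ioo_le_finrank_add_finrank hA hA_semi hCp hCm hlt hgap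
    (hends α (Or.inl rfl)).2.2
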